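/- Let $k\ge 1$ be a fixed integer and let $\beta\in(0,1)$, $\sigma>0$ be fixed. For $d\ge k$ let $\mathcal U_{k,d}$ be the set of all $u\subseteq\{1,\dots,d\}$ with $\#u=k$, and for $u\in\mathcal U_{k,d}$ let $\mathring{\mathbb Z}_u=\{\ell\in\mathbb Z^d:\ \ell_j\ne 0\iff j\in u\}$; put $c_\ell^2=\big(\sum_j(2\pi \ell_j)^2\big)^{\sigma}$. One observes $$X_\ell=\eta_u\theta_\ell(u)+\varepsilon\xi_\ell,\qquad \ell\in\mathring{\mathbb Z}_u,\ u\in\mathcal U_{k,d},$$ with i.i.d. standard normal $\xi_\ell$, $\eta_u\in\{0,1\}$ and $\varepsilon>0$. For $r>0$ let $\mathring\Theta_{c_u}(r)$ be the set of square summable $\theta_u=(\theta_\ell)_{\ell\in\mathring{\mathbb Z}_u}$ with $\sum_\ell\theta_\ell^2c_\ell^2\le1$ and $\sum_\ell\theta_\ell^2\ge r^2$, and let $\Theta^d_{k,\sigma}(r)$ be the set of families $\theta=(\theta_u)_{u\in\mathcal U_{k,d}}$ with $\theta_u\in\mathring\Theta_{c_u}(r)$ for all $u$. Put $$a_{\varepsilon,u}^2(r)=\frac1{2\varepsilon^4}\inf_{\theta_u\in\mathring\Theta_{c_u}(r)}\sum_{\ell\in\mathring{\mathbb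 Z}_u}\theta_\ell^4\qquad(\inf\emptyset=\infty),$$ let $(\theta^*_\ell(r))_\ell$ be a minimizing sequence, and $\omega_\ell(r)=\dfrac{[\theta_\ell^*(r)]^2}{2\varepsilon^2a_{\varepsilon,u}(r)}$. The quantity $a_{\varepsilon,u}(r)$ is the same for all $u$ with $\#u=k$; it is denoted $a_{\varepsilon,k}(r)$ (index set $(\mathbb Z\setminus\{0\})^k$). Let $d=d_\varepsilon\to\infty$ and $\log\binom dk=o(\log\varepsilon^{-1})$ as $\varepsilon\to0$. Let $\rho=\rho_\varepsilon>0$, $\rho\to0$, $M=\lfloor1/\rho\rfloor$ with $\log M=o(\log\binom dk)$, and let $\tau=\tau_\varepsilon>0$ satisfy $\tau\to0$ and $\tau\log\binom dk\to\infty$. For $m=1,\dots,M$ let $r^*_{\varepsilon,k,m}>0$ be determined by $a_{\varepsilon,u}(r^*_{\varepsilon,k,m})=(1+\sqrt{1-m\rho})\sqrt{2\log\binom dk}$, let $$S_{u,m}=\sum_{\ell\in\mathring{\mathbb Z}_u}\omega_\ell(r^*_{\varepsilon,k,m})\big[(X_\ell/\varepsilon)^2-1\big],$$ and define the selector (which does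 not depend on $\beta$) $$\hat\eta_u=\max_{1\le m\le M}\mathbf 1\Big\{S_{u,m}>\sqrt{(2+\tau)\big(\log\tbinom dk+\log M\big)}\Big\},\qquad u\in\mathcal U_{k,d}.$$ Let $\delta=\delta_\varepsilon\to0$ be arbitrary, and let $\mathcal H^d_{k,\beta}$ be the set of $\eta\in\{0,1\}^{\mathcal U_{k,d}}$ with $\big|\sum_u\eta_u-\binom dk^{1-\beta}\big|\le\delta\binom dk^{1-\beta}$, i.e. $\sum_u\eta_u=\binom dk^{1-\beta}(1+o(1))$ with a uniform $o(1)$. Theorem. If $r_{\varepsilon,k}>0$ satisfies $$\liminf_{\varepsilon\to0}\frac{a_{\varepsilon,k}(r_{\varepsilon,k})}{\sqrt{\log\binom dk}}>\sqrt2\,\big(1+\sqrt{1-\beta}\big),$$ then $\hat\eta$ achieves exact selection: $$\limsup_{\varepsilon\to0}\ \sup_{\eta\in\mathcal H^d_{k,\beta}}\ \sup_{\theta\in\Theta^d_{k,\sigma}(r_{\varepsilon,k})}\mathrm E_{\theta,\eta}\sum_{u\in\mathcal U_{k,d}}|\hat\eta_u-\eta_u|=0 .$$ -/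

import Mathlib

open Filter Topology MeasureTheory ProbabilityTheory

namespace ExactSelection

noncomputable section

/-- The index sets `u` of the components: subsets of the `d` coordinates of cardinality `k`. -/
abbrev Comp (k d : ℕ) : Type := {u : Finset (Fin d) // u.card = k}

/-- The frequencies of the component `u`: integer vectors whose nonzero coordinates are exactly
those with index in `u`.  For `d = k` and `u = Finset.univ` this is `(ℤ ∖ {0})^k`. -/
abbrev Freq {d : ℕ} (u : Finset (Fin d)) : Type := {l : Fin d → ℤ // ∀ j, l j ≠ 0 ↔ j ∈ u}

/-- The Sobolev coefficients `c_l`, with `c_l ^ 2 = (∑ j, (2 π l_j) ^ 2) ^ σ`. -/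
def coeff (σ : ℝ) {d : ℕ} (u : Finset (Fin d)) (l : Freq u) : ℝ :=
  (∑ j, (2 * Real.pi * (l.1 j : ℝ)) ^ 2) ^ (σ / 2)

section Extremal

variable {I : Type} (c : I → ℝ)

/-- The ellipsoid with semi-axes `1 / c` in `ℓ²(I)`, with the open ball of radius `r` removed. -/
def PuncturedEllipsoid (r : ℝ) : Set (I → ℝ) :=
  {θ | Summable (fun i => θ i ^ 2) ∧ Summable (fun i => θ i ^ 2 * c i ^ 2) ∧
    ∑' i, θ i ^ 2 * c i ^ 2 ≤ 1 ∧ r ^ 2 ≤ ∑' i, θ i ^ 2}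

/-- `a² = (2 ε⁴)⁻¹ inf ∑ θ_i⁴`, the infimum being over `PuncturedEllipsoid c r` (and `∞` if that is empty). -/
def aSq (ε r : ℝ) : ENNReal :=
  ⨅ θ ∈ PuncturedEllipsoid c r, ENNReal.ofReal (1 / (2 * ε ^ 4) * ∑' i, θ i ^ 4)

/-- The nonnegative square root of `aSq`. -/
def aVal (ε r : ℝ) : ENNReal := aSq c ε r ^ (1 / 2 : ℝ)

/-- `θ` attains the infimum of `∑ θ_i⁴` over `PuncturedEllipsoid c r`. -/
def IsExtremal (r : ℝ) (θ : I → ℝ) : Prop :=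
  θ ∈ PuncturedEllipsoid c r ∧ ∀ θ' ∈ PuncturedEllipsoid c r, ∑' i, θ i ^ 4 ≤ ∑' i, θ' i ^ 4

/-- A minimizing sequence (chosen among the minimizers, which differ only by the signs of their
terms; only the squares of the terms are used). -/
def thetaStar (r : ℝ) : I → ℝ := Classical.epsilon (IsExtremal c r)

/-- The weights `ω_i(r) = (2 ε²)⁻¹ θ*_i(r)² / a(r)`. -/
def weight (ε r : ℝ) (i : I) : ℝ :=
  1 / (2 * ε ^ 2) * (thetaStar c r i ^ 2 / (aVal c ε r).toReal)

/-- The positive solution `r*` of `a(r*) = level`. -/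
def rStar (ε level : ℝ) : ℝ :=
  Classical.epsilon fun r : ℝ => 0 < r ∧ aVal c ε r = ENNReal.ofReal level

end Extremal

/-- The function `a_{ε,k}(r)`, over the frequencies `(ℤ ∖ {0})^k`. -/
def aK (σ ε : ℝ) (k : ℕ) (r : ℝ) : ENNReal :=
  aVal (coeff σ (Finset.univ : Finset (Fin k))) ε r

/-- `log (d choose k)`. -/
def logBinom (k d : ℕ) : ℝ := Real.log (d.choose k : ℝ)

/-- Indices `(u, l)` of the observations. -/
abbrev ObsIndex (k d : ℕ) : Type := Σ u : Comp k d, Freq u.1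

/-- The number `M = ⌊1 / ρ⌋` of points `m ρ`, `1 ≤ m ≤ M`, of the grid. -/
def gridSize (ρ : ℝ) : ℕ := ⌊1 / ρ⌋₊

/-- The radius `r*_{ε,k,m}`: `a_{ε,u}(r*) = (1 + √(1 - m ρ)) √(2 log (d choose k))`. -/
def rStarGrid (σ ε ρ : ℝ) {k d : ℕ} (u : Comp k d) (m : ℕ) : ℝ :=
  rStar (coeff σ u.1) ε ((1 + √(1 - m * ρ)) * √(2 * logBinom k d))

/-- The weighted chi-square type statistic `S_{u,m}` of the observation `X`. -/
def stat (σ ε ρ : ℝ) {k d : ℕ} (X : ObsIndex k d → ℝ) (u : Comp k d) (m : ℕ) : ℝ :=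
  ∑' l : Freq u.1,
    weight (coeff σ u.1) ε (rStarGrid σ ε ρ u m) l * ((X ⟨u, l⟩ / ε) ^ 2 - 1)

/-- The common threshold `√((2 + τ) (log (d choose k) + log M))`. -/
def threshold (ρ τ : ℝ) (k d : ℕ) : ℝ :=
  √((2 + τ) * (logBinom k d + Real.log (gridSize ρ)))

open Classical in
/-- The adaptive selector: the maximum over the grid of the indicators `S_{u,m} > threshold`. -/
def selector (σ ε ρ τ : ℝ) {k d : ℕ} (X : ObsIndex k d → ℝ) (u : Comp k d) : ℕ :=
  (Finset.Icc 1 (gridSize ρ)).sup fun m =>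
    if threshold ρ τ k d < stat σ ε ρ X u m then 1 else 0

/-- The law of the noise: independent standard normal variables. -/
def noise (k d : ℕ) : Measure (ObsIndex k d → ℝ) :=
  Measure.infinitePi fun _ => gaussianReal 0 1

/-- The sequence space model `X_l = η_u θ_l(u) + ε ξ_l`. -/
def observe (ε : ℝ) {k d : ℕ} (η : Comp k d → ℕ) (θ : (u : Comp k d) → Freq u.1 → ℝ)
    (ξ : ObsIndex k d → ℝ) (i : ObsIndex k d) : ℝ :=
  (η i.1 : ℝ) * θ i.1 i.2 + ε * ξ i

/-- The Hamming risk `E_{θ,η} ∑_u |est_u - η_u|` of the estimator `est`. -/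
def hammingRisk (ε : ℝ) {k d : ℕ} (est : (ObsIndex k d → ℝ) → Comp k d → ℕ)
    (η : Comp k d → ℕ) (θ : (u : Comp k d) → Freq u.1 → ℝ) : ENNReal :=
  ∫⁻ ξ, ENNReal.ofReal (∑ u, |(est (observe ε η θ ξ) u : ℝ) - (η u : ℝ)|) ∂(noise k d)

/-- The sparse 0/1 vectors: the number of ones is `(d choose k)^(1-β)` up to a relative error of
at most `δ`. -/
def Sparse (k d : ℕ) (β δ : ℝ) : Set (Comp k d → ℕ) :=
  {η | (∀ u, η u = 0 ∨ η u = 1) ∧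
    |(∑ u, (η u : ℝ)) - (d.choose k : ℝ) ^ (1 - β)| ≤ δ * (d.choose k : ℝ) ^ (1 - β)}

/-- The signals all of whose components lie in the respective ellipsoid with a ball removed. -/
def Signals (k d : ℕ) (σ r : ℝ) : Set ((u : Comp k d) → Freq u.1 → ℝ) :=
  {θ | ∀ u, θ u ∈ PuncturedEllipsoid (coeff σ u.1) r}

end

end ExactSelection

open ExactSelection

/-! With `x = θ ^ 2` the extremal problem asks for the shortest vector `x` of a convex set. The
weights `ω` are proportional to it, normalized by `∑ ω ^ 2 = 1 / 2`, so that each statistic has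
variance one under pure noise. The variational inequality `∑ x ^ 2 ≤ ∑ x * y` says that any signal
outside the ball of radius `r*` shifts the mean of the statistic by at least `a(r*)`
(`IsLeast2.le_tsum_mul`, `goodWeight`).

The largest weight is at most a constant times a positive power of `ε ^ 4 * a ^ 2`
(`exists_goodWeight`). Since `L = log (d choose k)` is `o(log ε⁻¹)`, it vanishes faster than any
power of `L`, and the Chernoff bounds for the weighted chi-square sums become those of a normal
variable with variance one, up to negligible corrections (`measure_lt_weighted_sum_le`,
`measure_weighted_sum_le_le`).

With threshold `t`, `t ^ 2 = (2 + τ) * (L + log M)`, false positives cost at most about `exp (L +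
log M - t ^ 2 / 2)`, which vanishes because `τ * L → ∞`. For false negatives a single grid point
suffices: with `p = √(1 - β)`, take `m₀` such that `√(1 - m₀ ρ)` is at least some `q > p` but below
the slack in the hypothesis on `r`. There are about `exp (p ^ 2 * L)` active components, and each is
missed with probability about `exp (-q ^ 2 * L)`. All bounds are uniform in `η` and `θ`
(`hammingRisk_le`), and adaptation to `β` costs only `log M = o(L)`. -/

namespace ExactSelection
-- The shortest vector of the convex feasible set: existence, optimality, size and support.
section ConvexProgram

variable {I : Type} {c : I → ℝ} {R : ℝ} {x : I → ℝ}

/-- The set of squares of the elements of the punctured ellipsoid with `r ^ 2 = R`; it is convex. -/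
def Feasible (c : I → ℝ) (R : ℝ) : Set (I → ℝ) :=
  {x | (∀ i, 0 ≤ x i) ∧ ∃ A B, HasSum x A ∧ HasSum (fun i => x i * c i ^ 2) B ∧ B ≤ 1 ∧ R ≤ A}

/-- `x` has least square sum in `Feasible c R`. -/
def IsLeast2 (c : I → ℝ) (R : ℝ) (x : I → ℝ) : Prop :=
  x ∈ Feasible c R ∧ ∀ y ∈ Feasible c R, ∑' i, x i ^ 2 ≤ ∑' i, y i ^ 2

lemma hasSum_of_eq {f g : I → ℝ} {a : ℝ} (h : HasSum f a) (hfg : ∀ i, g i = f i) :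
    HasSum g a :=
  funext hfg ▸ h

lemma summable_mul_of_nonneg {x y : I → ℝ} (hx : ∀ i, 0 ≤ x i) (hy : ∀ i, 0 ≤ y i)
    (sx : Summable x) (sy : Summable y) : Summable fun i => x i * y i := by
  have h := sx.mul_of_nonneg sy (fun i => hx i) (fun i => hy i)
  exact h.comp_injective (i := fun i : I => (i, i)) (fun a b hab => (Prod.ext_iff.1 hab).1)

lemma Feasible.nonneg (h : x ∈ Feasible c R) (i : I) : 0 ≤ x i := h.1 i

lemma Feasible.summable (h : x ∈ Feasible c R) : Summable x := by
  obtain ⟨_, A, B, hA, -⟩ := h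
  exact hA.summable

lemma Feasible.summable_mul {y : I → ℝ} {R' : ℝ} (h : x ∈ Feasible c R)
    (h' : y ∈ Feasible c R') : Summable fun i => x i * y i :=
  summable_mul_of_nonneg h.1 h'.1 (Feasible.summable h) (Feasible.summable h')

lemma Feasible.summable_sq (h : x ∈ Feasible c R) : Summable fun i => x i ^ 2 := by
  simpa only [sq] using Feasible.summable_mul h h

lemma Feasible.anti {R' : ℝ} (hR : R ≤ R') (h : x ∈ Feasible c R') : x ∈ Feasible c R := by
  obtain ⟨h0, A, B, hA, hB, h1, h2⟩ := h
  exact ⟨h0, A, B, hA, hB, h1, hR.trans h2⟩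

lemma Feasible.combo {y : I → ℝ} {R' s t : ℝ} (hx : x ∈ Feasible c R) (hy : y ∈ Feasible c R')
    (hs : 0 ≤ s) (ht : 0 ≤ t) (hst : s + t = 1) :
    (fun i => s * x i + t * y i) ∈ Feasible c (s * R + t * R') := by
  obtain ⟨h0, A, B, hA, hB, h1, h2⟩ := hx
  obtain ⟨h0', A', B', hA', hB', h1', h2'⟩ := hy
  refine ⟨fun i => add_nonneg (mul_nonneg hs (h0 i)) (mul_nonneg ht (h0' i)),
    s * A + t * A', s * B + t * B', (hA.mul_left s).add (hA'.mul_left t), ?_, ?_, ?_⟩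
  · exact hasSum_of_eq ((hB.mul_left s).add (hB'.mul_left t)) fun i => by ring
  · nlinarith
  · exact add_le_add (mul_le_mul_of_nonneg_left h2 hs) (mul_le_mul_of_nonneg_left h2' ht)

/-- The square sum of a convex combination, expanded. -/
lemma Feasible.hasSum_combo_sq {y : I → ℝ} {R' : ℝ} (hx : x ∈ Feasible c R)
    (hy : y ∈ Feasible c R') (s t : ℝ) :
    HasSum (fun i => (s * x i + t * y i) ^ 2)
      (s ^ 2 * ∑' i, x i ^ 2 + 2 * s * t * ∑' i, x i * y i + t ^ 2 * ∑' i, y i ^ 2) := by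
  exact hasSum_of_eq (((((Feasible.summable_sq hx).hasSum.mul_left (s ^ 2)).add
    ((Feasible.summable_mul hx hy).hasSum.mul_left (2 * s * t)))).add
    ((Feasible.summable_sq hy).hasSum.mul_left (t ^ 2))) fun i => by ring

/-- The variational inequality for the least element of a convex set. -/
lemma IsLeast2.le_tsum_mul (h : IsLeast2 c R x) {y : I → ℝ} (hy : y ∈ Feasible c R) :
    ∑' i, x i ^ 2 ≤ ∑' i, x i * y i := by
  set X := ∑' i, x i ^ 2
  set P := ∑' i, x i * y i with hP
  set Y := ∑' i, y i ^ 2 with hY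
  by_contra! hlt
  have key : ∀ s : ℝ, 0 < s → s < 1 → 0 ≤ 2 * (P - X) + s * (X - 2 * P + Y) := by
    intro s hs hs1
    have hz := Feasible.combo h.1 hy (sub_nonneg.2 hs1.le) hs.le (by ring)
    have h1 := h.2 _ (by convert hz using 1; ring_nf)
    rw [(Feasible.hasSum_combo_sq h.1 hy (1 - s) s).tsum_eq] at h1
    have : 0 ≤ s * (2 * (P - X) + s * (X - 2 * P + Y)) := by
      have h2 : X ≤ (1 - s) ^ 2 * X + 2 * (1 - s) * s * P + s ^ 2 * Y := h1
      nlinarith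
    exact nonneg_of_mul_nonneg_right this hs
  have hlim : Tendsto (fun s : ℝ => 2 * (P - X) + s * (X - 2 * P + Y)) (𝓝[>] 0)
      (𝓝 (2 * (P - X) + 0 * (X - 2 * P + Y))) :=
    ((continuous_const.add (continuous_id.mul continuous_const)).tendsto 0).mono_left
      nhdsWithin_le_nhds
  have := ge_of_tendsto hlim (by
    filter_upwards [Ioo_mem_nhdsGT (zero_lt_one (α := ℝ))] with s hs using key s hs.1 hs.2)
  linarith

/-- First-order optimality along `s • (-x) + v`. -/
lemma IsLeast2.variation (h : IsLeast2 c R x) {v : I → ℝ} {s a b p A B : ℝ}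
    (hA : HasSum x A) (hB : HasSum (fun i => x i * c i ^ 2) B)
    (ha : HasSum v a) (hb : HasSum (fun i => v i * c i ^ 2) b)
    (hp : HasSum (fun i => x i * v i) p) (h0 : ∀ i, 0 ≤ (1 - s) * x i + v i)
    (h1 : (1 - s) * B + b ≤ 1) (h2 : R ≤ (1 - s) * A + a) :
    s * ∑' i, x i ^ 2 ≤ p := by
  have hy : (fun i => (1 - s) * x i + v i) ∈ Feasible c R := by
    refine ⟨h0, _, _, (hA.mul_left (1 - s)).add ha, ?_, h1, h2⟩
    exact hasSum_of_eq ((hB.mul_left (1 - s)).add hb) fun i => by ring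
  have h3 := h.le_tsum_mul hy
  have h4 : HasSum (fun i => x i * ((1 - s) * x i + v i)) ((1 - s) * (∑' i, x i ^ 2) + p) := by
    exact hasSum_of_eq (((Feasible.summable_sq h.1).hasSum.mul_left (1 - s)).add hp) fun i => by ring
  rw [h4.tsum_eq] at h3
  linarith

lemma hasSum_single_mul [DecidableEq I] (i : I) (t : ℝ) (f : I → ℝ) :
    HasSum (fun j => (Pi.single i t : I → ℝ) j * f j) (t * f i) := by
  convert hasSum_single (f := fun j => (Pi.single i t : I → ℝ) j * f j) i ?_ using 1
  · simp
  · intro j hj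
    simp [Pi.single_eq_of_ne hj]

open Classical in
lemma hasSum_indicator_mul (J : Finset I) (t : ℝ) (f : I → ℝ) :
    HasSum (fun j => (if j ∈ J then t else 0) * f j) (t * ∑ j ∈ J, f j) := by
  convert hasSum_sum_of_ne_finset_zero (f := fun j => (if j ∈ J then t else 0) * f j)
    (s := J) (L := .unconditional I) ?_ using 1
  · rw [Finset.mul_sum]
    exact Finset.sum_congr rfl fun j hj => by simp [hj]
  · intro j hj
    simp [hj]

open Classical in
/-- The terms of the least element are small against its norm, if many semi-axes are long. -/
lemma IsLeast2.sq_mul_card_le (h : IsLeast2 c R x) (hR : 0 ≤ R) {K : ℝ} (hK : 0 < K)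
    (hKR : K ^ 2 * R ≤ 1 / 2) (J : Finset I) (hJ : ∀ j ∈ J, 0 ≤ c j ∧ c j ≤ K) (i : I) :
    x i ^ 2 * J.card ≤ 4 * ∑' i, x i ^ 2 := by
  rcases J.eq_empty_or_nonempty with rfl | hne
  · simpa using mul_nonneg (by norm_num : (0:ℝ) ≤ 4) (tsum_nonneg fun i => sq_nonneg (x i))
  have hN : (0 : ℝ) < J.card := by exact_mod_cast hne.card_pos
  rcases (h.1.1 i).eq_or_lt with hi | hi
  · rw [← hi]
    simpa using mul_nonneg (by norm_num : (0:ℝ) ≤ 4) (tsum_nonneg fun i => sq_nonneg (x i))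
  have hX := Feasible.summable_sq h.1
  have hle : x i ≤ 2 / J.card * ∑ j ∈ J, x j := by
    obtain ⟨h0, A, B, hA, hB, hB1, hRA⟩ := id h.1
    have hB0 : 0 ≤ B := hB.nonneg fun i => mul_nonneg (h0 i) (sq_nonneg _)
    -- The competitor takes `t` from the term at `i`, adds `q` on each index of `J` and shrinks `x`
    -- by the factor `1 - s`. The shrinking with `s = 2 * t * K ^ 2` frees the budget spent on `J`,
    -- and `q` restores the sum to at least `R`. The two upper bounds on `t` give `s ≤ 1 / 2` and
    -- keep the term at `i` nonnegative.
    obtain ⟨t, ht, hts, htx⟩ : ∃ t : ℝ, 0 < t ∧ 2 * t * K ^ 2 ≤ 1 / 2 ∧ 2 * t ≤ x i := by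
      refine ⟨min (1 / (4 * K ^ 2)) (x i / 2), by positivity, ?_, ?_⟩
      · calc 2 * min (1 / (4 * K ^ 2)) (x i / 2) * K ^ 2 ≤ 2 * (1 / (4 * K ^ 2)) * K ^ 2 := by
              gcongr; exact min_le_left _ _
          _ = 1 / 2 := by field_simp; norm_num
      · linarith [min_le_right (1 / (4 * K ^ 2)) (x i / 2)]
    set s := 2 * t * K ^ 2 with hs
    set q := (s * R + t) / J.card with hq
    have hq0 : 0 ≤ q := by positivity
    have hs0 : 0 ≤ s := by positivity
    have hqN : q * J.card = s * R + t := by rw [hq]; field_simp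
    have hsR : s * R ≤ t := by
      have : s * R = 2 * t * (K ^ 2 * R) := by rw [hs]; ring
      nlinarith
    have hv : ∀ f : I → ℝ, HasSum
        (fun j => ((if j ∈ J then q else 0) + (Pi.single i (-t) : I → ℝ) j) * f j)
        (q * ∑ j ∈ J, f j + -t * f i) := by
      intro f
      exact hasSum_of_eq ((hasSum_indicator_mul J q f).add (hasSum_single_mul i (-t) f)) fun i => by ring
    have hcJ : ∑ j ∈ J, c j ^ 2 ≤ J.card * K ^ 2 := by
      rw [← nsmul_eq_mul]
      exact Finset.sum_le_card_nsmul _ _ _ fun j hj => pow_le_pow_left₀ (hJ j hj).1 (hJ j hj).2 2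
    have hvar := h.variation (s := s) hA hB (by simpa using hv fun _ => 1)
      (hv fun j => c j ^ 2) (by simpa only [mul_comm (x _)] using hv x) ?_ ?_ ?_
    · have hS : 0 ≤ ∑ j ∈ J, x j := Finset.sum_nonneg fun j _ => h0 j
      have hsX : 0 ≤ s * ∑' i, x i ^ 2 := mul_nonneg hs0 (tsum_nonneg fun i => sq_nonneg _)
      have h5 : q ≤ 2 * t / J.card := by
        rw [hq]; gcongr; linarith
      have h6 : t * x i ≤ t * (2 / J.card * ∑ j ∈ J, x j) := by
        calc t * x i ≤ q * ∑ j ∈ J, x j := by linarith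
          _ ≤ 2 * t / J.card * ∑ j ∈ J, x j := by gcongr
          _ = _ := by ring
      exact le_of_mul_le_mul_left h6 ht
    · intro j
      by_cases hj : j = i
      · subst hj
        simp only [Pi.single_eq_same]
        have : 0 ≤ if j ∈ J then q else 0 := by split_ifs <;> simp [hq0]
        nlinarith
      · rw [Pi.single_eq_of_ne hj, add_zero]
        have : 0 ≤ if j ∈ J then q else 0 := by split_ifs <;> simp [hq0]
        have := h0 j
        nlinarith
    · have h7 : q * ∑ j ∈ J, c j ^ 2 ≤ s := by
        calc q * ∑ j ∈ J, c j ^ 2 ≤ q * (J.card * K ^ 2) := by gcongr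
          _ = s * (K ^ 2 * R) + t * K ^ 2 := by rw [← mul_assoc, hqN]; ring
          _ ≤ s * (1 / 2) + t * K ^ 2 := by gcongr
          _ = s := by rw [hs]; ring
      have : 0 ≤ t * c i ^ 2 := by positivity
      nlinarith
    · have : q * (∑ _j ∈ J, (1 : ℝ)) = s * R + t := by simp [hqN]
      nlinarith
  have hcs : (∑ j ∈ J, x j) ^ 2 ≤ J.card * ∑' i, x i ^ 2 := by
    refine sq_sum_le_card_mul_sum_sq.trans ?_
    gcongr
    exact hX.sum_le_tsum _ fun i _ => sq_nonneg _
  calc x i ^ 2 * J.card ≤ (2 / J.card * ∑ j ∈ J, x j) ^ 2 * J.card := by gcongr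
    _ = 4 / J.card * (∑ j ∈ J, x j) ^ 2 := by field_simp; ring
    _ ≤ 4 / J.card * (J.card * ∑' i, x i ^ 2) := by gcongr
    _ = _ := by field_simp

/-- Outside `J` the budget leaves a sum of at most `1 / K ^ 2 ≤ R / 2`, so `J` carries at least `R /
2`; Cauchy-Schwarz on `J` does the rest. -/
lemma Feasible.sq_le (h : x ∈ Feasible c R) (hR : 0 ≤ R) {K : ℝ} (hK : 0 < K)
    (hKR : 2 ≤ K ^ 2 * R) (J : Finset I) (hJ : ∀ j, j ∉ J → K ≤ c j) :
    R ^ 2 ≤ 4 * J.card * ∑' i, x i ^ 2 := by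
  obtain ⟨h0, A, B, hA, hB, hB1, hRA⟩ := id h
  have hcs : (∑ j ∈ J, x j) ^ 2 ≤ J.card * ∑' i, x i ^ 2 := by
    refine sq_sum_le_card_mul_sum_sq.trans ?_
    gcongr
    exact (Feasible.summable_sq h).sum_le_tsum _ fun i _ => sq_nonneg _
  have h1 : A ≤ ∑ j ∈ J, x j + (K ^ 2)⁻¹ * B := by
    classical
    refine hasSum_le (fun i => ?_) hA
      ((by simpa using hasSum_indicator_mul J 1 x :
        HasSum _ (∑ j ∈ J, x j)).add (hB.mul_left (K ^ 2)⁻¹))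
    by_cases hi : i ∈ J
    · have : 0 ≤ (K ^ 2)⁻¹ * (x i * c i ^ 2) := by have := h0 i; positivity
      simpa [hi] using this
    · have h3 : K ^ 2 ≤ c i ^ 2 := pow_le_pow_left₀ hK.le (hJ i hi) 2
      simp only [hi, if_false, zero_add]
      rw [inv_mul_eq_div, le_div_iff₀ (by positivity)]
      exact mul_le_mul_of_nonneg_left h3 (h0 i)
  have h2 : (K ^ 2)⁻¹ * B ≤ R / 2 := by
    rw [inv_mul_eq_div, div_le_iff₀ (by positivity)]
    linarith
  have h3 : R / 2 ≤ ∑ j ∈ J, x j := by linarith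
  nlinarith

open Classical in
/-- Only finitely many terms of the least element do not vanish. -/
lemma IsLeast2.finite_support [Infinite I] (h : IsLeast2 c R x) (hR : 0 < R)
    (hfin : ∀ K, {i | c i ≤ K}.Finite) (hc : ∀ i, 0 ≤ c i) : x.support.Finite := by
  by_contra hinf
  obtain ⟨h0, A, B, hA, hB, hB1, hRA⟩ := id h.1
  obtain ⟨j, hj⟩ : ∃ j, 0 < x j := by
    by_contra! hle
    have : x = fun _ => 0 := funext fun i => le_antisymm (hle i) (h0 i)
    rw [this] at hA
    linarith [hA.unique hasSum_zero]
  -- a term smaller than `x j`, with a shorter semi-axis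
  obtain ⟨l, hlj, hcl⟩ : ∃ l, x l < x j ∧ c j < c l := by
    have h1 : ∀ᶠ i in cofinite, x i < x j :=
      hA.summable.tendsto_cofinite_zero.eventually (gt_mem_nhds hj)
    have h2 : ∀ᶠ i in cofinite, c j < c i := by
      refine (hfin (c j)).subset fun i hi => ?_
      simpa using hi
    exact (h1.and h2).exists
  -- a nonzero term with an even shorter one
  obtain ⟨D, hD⟩ : ∃ D : ℝ, D = c l ^ 2 - c j ^ 2 := ⟨_, rfl⟩
  have hDpos : 0 < D := by
    have := hc j
    rw [hD]; nlinarith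
  -- Mass `s` will move from `j` to `l` and mass `s * q` from `i` to `l`. This `q` is so small that
  -- the gain `x j - x l` outweighs `q * x l`; the `+ 1` keeps the denominator positive when `x l =
  -- 0`. The far index `i` is then chosen so that removing mass there pays for the increase `D` of
  -- the budget.
  set q := (x j - x l) / (x l + 1) / 2 with hq
  have hl0 := h0 l
  have hqpos : 0 < q := by
    have : 0 < x j - x l := sub_pos.2 hlj
    positivity
  obtain ⟨i, hi, hci⟩ : ∃ i, 0 < x i ∧ c l ^ 2 + D / q + 1 ≤ c i ^ 2 := by
    by_contra! hcon
    refine hinf ((hfin (c l ^ 2 + D / q + 1 + 1)).subset fun i hi => ?_)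
    have h1 := hcon i ((h0 i).lt_of_ne (Ne.symm hi))
    simp only [Set.mem_ofPred_eq]
    nlinarith [sq_nonneg (c i - 1)]
  have hDq : 0 < D / q := by positivity
  have hij : i ≠ j := by rintro rfl; nlinarith
  have hil : i ≠ l := by rintro rfl; linarith
  have hjl : j ≠ l := by rintro rfl; exact lt_irrefl _ hlj
  obtain ⟨s, hs, hsj, hsi⟩ : ∃ s : ℝ, 0 < s ∧ s ≤ x j ∧ s * q ≤ x i := by
    refine ⟨min (x j) (x i / q), by positivity, min_le_left _ _, ?_⟩
    calc min (x j) (x i / q) * q ≤ x i / q * q := by gcongr; exact min_le_right _ _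
      _ = x i := by field_simp
  have hv : ∀ f : I → ℝ, HasSum (fun k => ((Pi.single i (-(s * q)) : I → ℝ) k
      + (Pi.single j (-s) : I → ℝ) k + (Pi.single l (s + s * q) : I → ℝ) k) * f k)
      (-(s * q) * f i + -s * f j + (s + s * q) * f l) := by
    intro f
    exact hasSum_of_eq (((hasSum_single_mul i (-(s * q)) f).add (hasSum_single_mul j (-s) f)).add
      (hasSum_single_mul l (s + s * q) f)) fun i => by ring
  have hsq : 0 < s * q := by positivity
  -- The transfer preserves the sum and does not increase the budget, so no shrinking is needed; but
  -- it lowers the objective to first order, a contradiction.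
  have hvar := h.variation (s := 0) hA hB (by simpa using hv fun _ => 1)
      (hv fun k => c k ^ 2) (by simpa only [mul_comm (x _)] using hv x) ?_ ?_ ?_
  · have h1 : q * (x l + 1) * 2 = x j - x l := by rw [hq]; field_simp
    have h2 : 0 ≤ -(s * q) * x i + -s * x j + (s + s * q) * x l := by simpa using hvar
    have h3 : 0 ≤ s * (-(q * x i) - x j + (1 + q) * x l) := by nlinarith
    have h4 := nonneg_of_mul_nonneg_right h3 hs
    have h5 : 0 < q * x i := by positivity
    nlinarith
  · intro k
    have hk := h0 k
    by_cases h1 : k = i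
    · subst h1
      rw [Pi.single_eq_same, Pi.single_eq_of_ne hij, Pi.single_eq_of_ne hil]
      linarith
    rw [Pi.single_eq_of_ne h1]
    by_cases h2 : k = j
    · subst h2
      rw [Pi.single_eq_same, Pi.single_eq_of_ne hjl]
      linarith
    rw [Pi.single_eq_of_ne h2]
    by_cases h3 : k = l
    · subst h3
      rw [Pi.single_eq_same]
      nlinarith
    rw [Pi.single_eq_of_ne h3]
    linarith
  · have h1 : s * q * (D / q) = s * D := by field_simp
    have h2 : s * q * (c l ^ 2 + D / q) ≤ s * q * c i ^ 2 := by gcongr; linarith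
    rw [mul_add, h1, hD] at h2
    nlinarith
  · linarith

/-- Existence of the least element, by compactness. -/
lemma exists_isLeast2 (hc : ∀ i, 0 < c i) (hfin : ∀ K, {i | c i ≤ K}.Finite)
    (hne : (Feasible c R).Nonempty) : ∃ x, IsLeast2 c R x := by
  set J : ℝ → Finset I := fun K => (hfin K).toFinset with hJ
  have hJmem : ∀ K i, i ∈ J K ↔ c i ≤ K := fun K i => by simp [hJ]
  -- a description by closed conditions
  have hset : Feasible c R = {x | ∀ i, 0 ≤ x i} ∩
      ((⋂ S : Finset I, {x | ∑ i ∈ S, x i * c i ^ 2 ≤ 1}) ∩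
        ⋂ K : Set.Ioi (0 : ℝ), {x | R ≤ ∑ i ∈ J K, x i + ((K : ℝ) ^ 2)⁻¹}) := by
    ext x
    simp only [Set.mem_inter_iff, Set.mem_iInter, Set.mem_ofPred_eq]
    constructor
    · rintro ⟨h0, A, B, hA, hB, hB1, hRA⟩
      refine ⟨h0, fun S => ?_, fun K => ?_⟩
      · exact (sum_le_hasSum S (fun i _ => mul_nonneg (h0 i) (sq_nonneg _)) hB).trans hB1
      · have hK : (0 : ℝ) < K := K.2
        refine hRA.trans ?_
        -- The budget bounds the tail of the sum uniformly over the feasible set. No mass escapes to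
        -- infinity, and so `R ≤ ∑ x` survives pointwise limits.
        have : A ≤ ∑ i ∈ J K, x i + ((K : ℝ) ^ 2)⁻¹ * B := by
          classical
          refine hasSum_le (fun i => ?_) hA
            ((by simpa using hasSum_indicator_mul (J K) 1 x :
              HasSum _ (∑ j ∈ J K, x j)).add (hB.mul_left ((K : ℝ) ^ 2)⁻¹))
          by_cases hi : i ∈ J K
          · have : 0 ≤ ((K : ℝ) ^ 2)⁻¹ * (x i * c i ^ 2) := by have := h0 i; positivity
            simpa [hi] using this
          · have h3 : (K : ℝ) ^ 2 ≤ c i ^ 2 :=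
              pow_le_pow_left₀ hK.le (not_le.1 ((hJmem K i).not.1 hi)).le 2
            simp only [hi, if_false, zero_add]
            rw [inv_mul_eq_div, le_div_iff₀ (by positivity)]
            exact mul_le_mul_of_nonneg_left h3 (h0 i)
        have h4 : ((K : ℝ) ^ 2)⁻¹ * B ≤ ((K : ℝ) ^ 2)⁻¹ * 1 := by gcongr
        linarith
    · rintro ⟨h0, hS, hK⟩
      have h0' : ∀ i, 0 ≤ x i * c i ^ 2 := fun i => mul_nonneg (h0 i) (sq_nonneg _)
      have hsum : Summable fun i => x i * c i ^ 2 := summable_of_sum_le h0' hS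
      have hsx : Summable x := by
        refine hsum.of_norm_bounded_eventually ?_
        refine (hfin 1).subset fun i hi => ?_
        by_contra hi1
        have hi1 : 1 < c i := by simpa using hi1
        refine hi ?_
        change ‖x i‖ ≤ x i * c i ^ 2
        rw [Real.norm_of_nonneg (h0 i)]
        exact le_mul_of_one_le_right (h0 i) (one_le_pow₀ hi1.le)
      refine ⟨h0, _, _, hsx.hasSum, hsum.hasSum, hsum.tsum_le_of_sum_le hS, ?_⟩
      have hlim : Tendsto (fun K : ℝ => ∑' i, x i + (K ^ 2)⁻¹) atTop (𝓝 (∑' i, x i + 0)) :=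
        tendsto_const_nhds.add (tendsto_inv_atTop_zero.comp (tendsto_pow_atTop two_ne_zero))
      rw [add_zero] at hlim
      refine ge_of_tendsto hlim ?_
      filter_upwards [eventually_gt_atTop 0] with K hK0
      refine (hK ⟨K, hK0⟩).trans ?_
      gcongr
      exact hsx.sum_le_tsum _ fun i _ => h0 i
  have hcomp : IsCompact (Feasible c R) := by
    refine (isCompact_univ_pi fun i => isCompact_Icc (a := (0 : ℝ)) (b := 1 / c i ^ 2)).of_isClosed_subset
      ?_ ?_
    · rw [hset]
      refine IsClosed.inter ?_ (IsClosed.inter (isClosed_iInter fun S => ?_)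
        (isClosed_iInter fun K => ?_))
      · simp only [Set.ofPred_forall]
        exact isClosed_iInter fun i => isClosed_le continuous_const (continuous_apply i)
      · exact isClosed_le (by fun_prop) continuous_const
      · exact isClosed_le continuous_const (by fun_prop)
    · intro x hx i _
      have hci := hc i
      refine ⟨hx.1 i, ?_⟩
      obtain ⟨h0, A, B, hA, hB, hB1, hRA⟩ := hx
      rw [le_div_iff₀ (by positivity)]
      exact (le_hasSum hB i fun j _ => mul_nonneg (h0 j) (sq_nonneg _)).trans hB1
  -- In the product topology the square sum is in general only lower semicontinuous, as a supremum
  -- of finite sums; a minimum on a compact set needs no more.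
  have hlsc : LowerSemicontinuousOn (fun x : I → ℝ => ∑' i, ENNReal.ofReal (x i ^ 2))
      (Feasible c R) := by
    refine LowerSemicontinuous.lowerSemicontinuousOn
      (lowerSemicontinuous_tsum fun i => Continuous.lowerSemicontinuous ?_) _
    exact ENNReal.continuous_ofReal.comp (by fun_prop)
  obtain ⟨x, hx, hmin⟩ := LowerSemicontinuousOn.exists_isMinOn hne hcomp hlsc
  refine ⟨x, hx, fun y hy => ?_⟩
  have h1 := hmin hy
  simp only [Set.mem_ofPred_eq] at h1
  rw [← ENNReal.ofReal_tsum_of_nonneg (fun i => sq_nonneg _) (Feasible.summable_sq hx),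
    ← ENNReal.ofReal_tsum_of_nonneg (fun i => sq_nonneg _) (Feasible.summable_sq hy)] at h1
  exact (ENNReal.ofReal_le_ofReal_iff (tsum_nonneg fun i => sq_nonneg _)).1 h1

/-- The least square sum takes every small positive value. -/
lemma exists_isLeast2_eq (hc : ∀ i, 0 < c i) (hfin : ∀ K, {i | c i ≤ K}.Finite) {i₀ : I}
    {R₀ v : ℝ} (hR₀ : 0 < R₀) (hR₀' : R₀ * c i₀ ^ 2 < 1) (hv : 0 < v)
    (hv' : ∀ x ∈ Feasible c R₀, v < ∑' i, x i ^ 2) :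
    ∃ R x, 0 < R ∧ R ≤ R₀ ∧ IsLeast2 c R x ∧ ∑' i, x i ^ 2 = v := by
  classical
  have hci := hc i₀
  have hmem : ∀ R, 0 ≤ R → R * c i₀ ^ 2 ≤ 1 → (Pi.single i₀ R : I → ℝ) ∈ Feasible c R := by
    intro R hR hR1
    refine ⟨fun i => ?_, R, R * c i₀ ^ 2, by simpa using hasSum_single_mul i₀ R fun _ => 1,
      hasSum_single_mul i₀ R _, hR1, le_rfl⟩
    by_cases h : i = i₀
    · subst h; simpa using hR
    · simp [Pi.single_eq_of_ne h]
  set s : Set ℝ := Set.Ioo 0 (1 / c i₀ ^ 2) with hs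
  have hex : ∀ R : s, ∃ x, IsLeast2 c R x := fun R =>
    exists_isLeast2 hc hfin ⟨_, hmem R R.2.1.le (by
      have := R.2.2.le
      rwa [le_div_iff₀ (by positivity)] at this)⟩
  choose g hg using hex
  set F : ℝ → ℝ := fun R => if h : R ∈ s then ∑' i, g ⟨R, h⟩ i ^ 2 else 0 with hF
  have hFeq : ∀ R (h : R ∈ s), F R = ∑' i, g ⟨R, h⟩ i ^ 2 := fun R h => by simp [hF, h]
  -- A convex combination of minimizers competes at the combined radius, so the value function is
  -- convex. On an open interval this already gives continuity, and the intermediate value theorem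
  -- applies.
  have hconv : ConvexOn ℝ s F := by
    refine ⟨convex_Ioo _ _, fun R hR R' hR' a b ha hb hab => ?_⟩
    have hmem' := (convex_Ioo _ _) hR hR' ha hb hab
    rw [hFeq _ hmem', hFeq _ hR, hFeq _ hR']
    set x := g ⟨R, hR⟩
    set y := g ⟨R', hR'⟩
    have hx : x ∈ Feasible c R := (hg ⟨R, hR⟩).1
    have hy : y ∈ Feasible c R' := (hg ⟨R', hR'⟩).1
    have h1 := (hg ⟨_, hmem'⟩).2 _ (Feasible.combo hx hy ha hb hab)
    refine h1.trans ?_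
    simp only [smul_eq_mul]
    refine hasSum_le (fun i => ?_) (Feasible.hasSum_combo_sq hx hy a b).summable.hasSum
      (((Feasible.summable_sq hx).hasSum.mul_left a).add
        ((Feasible.summable_sq hy).hasSum.mul_left b))
    have hb' : b = 1 - a := by linarith
    subst hb'
    nlinarith [mul_nonneg (mul_nonneg ha hb) (sq_nonneg (x i - y i))]
  have hcont : ContinuousOn F s := hconv.continuousOn isOpen_Ioo
  have hR₀s : R₀ ∈ s := ⟨hR₀, by rwa [lt_div_iff₀ (by positivity)]⟩
  -- The vector with the single term `R₁` at `i₀` has square sum `R₁ ^ 2 ≤ v`, which supplies the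
  -- lower end for the intermediate value theorem.
  obtain ⟨R₁, hR₁, hR₁₀, hR₁v⟩ : ∃ R₁ : ℝ, 0 < R₁ ∧ R₁ ≤ R₀ ∧ R₁ ^ 2 ≤ v :=
    ⟨min R₀ (√v), by positivity, min_le_left _ _, by
      calc min R₀ (√v) ^ 2 ≤ √v ^ 2 := by gcongr; exact min_le_right _ _
        _ = v := Real.sq_sqrt hv.le⟩
  have hR₁s : R₁ ∈ s := ⟨hR₁, hR₁₀.trans_lt hR₀s.2⟩
  have hsub : Set.Icc R₁ R₀ ⊆ s := fun R hR => ⟨hR₁.trans_le hR.1, hR.2.trans_lt hR₀s.2⟩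
  have hlow : F R₁ ≤ v := by
    rw [hFeq _ hR₁s]
    have := (hg ⟨R₁, hR₁s⟩).2 _ (hmem R₁ hR₁.le (by
      have := hR₁s.2.le
      rwa [le_div_iff₀ (by positivity)] at this))
    refine this.trans (le_trans (le_of_eq ?_) hR₁v)
    have h2 := (hasSum_single_mul i₀ R₁ (Pi.single i₀ R₁ : I → ℝ)).tsum_eq
    simpa [sq] using h2
  have hhigh : v ≤ F R₀ := by
    rw [hFeq _ hR₀s]
    exact (hv' _ (hg ⟨R₀, hR₀s⟩).1).le
  obtain ⟨R, hR, hRv⟩ := intermediate_value_Icc hR₁₀ (hcont.mono hsub) ⟨hlow, hhigh⟩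
  exact ⟨R, g ⟨R, hsub hR⟩, hR₁.trans_le hR.1, hR.2, hg _, by rw [← hFeq _ (hsub hR), hRv]⟩

end ConvexProgram
-- From the convex program to `a(r)`, the radius `r*` and the weights.
section ExtremalFunction

variable {I : Type} {c : I → ℝ} {r ε : ℝ}

/-- Both constraints are linear in the squares, which turns the nonconvex extremal problem into a
convex one. -/
lemma mem_puncturedEllipsoid_iff {θ : I → ℝ} :
    θ ∈ PuncturedEllipsoid c r ↔ (fun i => θ i ^ 2) ∈ Feasible c (r ^ 2) := by
  constructor
  · rintro ⟨h1, h2, h3, h4⟩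
    exact ⟨fun i => sq_nonneg _, _, _, h1.hasSum, h2.hasSum, h3, h4⟩
  · rintro ⟨-, A, B, hA, hB, h3, h4⟩
    exact ⟨hA.summable, hB.summable, hB.tsum_eq ▸ h3, hA.tsum_eq ▸ h4⟩

lemma sqrt_mem_puncturedEllipsoid {x : I → ℝ} (hx : x ∈ Feasible c (r ^ 2)) :
    (fun i => √(x i)) ∈ PuncturedEllipsoid c r := by
  rw [mem_puncturedEllipsoid_iff]
  simpa only [Real.sq_sqrt (Feasible.nonneg hx _)] using hx

lemma tsum_pow_four (θ : I → ℝ) : ∑' i, θ i ^ 4 = ∑' i, (θ i ^ 2) ^ 2 :=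
  tsum_congr fun i => by ring

lemma IsExtremal.isLeast2 {θ : I → ℝ} (h : IsExtremal c r θ) :
    IsLeast2 c (r ^ 2) fun i => θ i ^ 2 := by
  refine ⟨mem_puncturedEllipsoid_iff.1 h.1, fun y hy => ?_⟩
  have h1 := h.2 _ (sqrt_mem_puncturedEllipsoid hy)
  rw [tsum_pow_four, tsum_pow_four] at h1
  simpa only [Real.sq_sqrt (Feasible.nonneg hy _)] using h1

lemma IsLeast2.isExtremal_sqrt {x : I → ℝ} (h : IsLeast2 c (r ^ 2) x) :
    IsExtremal c r fun i => √(x i) := by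
  refine ⟨sqrt_mem_puncturedEllipsoid h.1, fun θ hθ => ?_⟩
  rw [tsum_pow_four, tsum_pow_four]
  simpa only [Real.sq_sqrt (Feasible.nonneg h.1 _)] using
    h.2 _ (mem_puncturedEllipsoid_iff.1 hθ)

lemma IsExtremal.aSq_eq {θ : I → ℝ} (h : IsExtremal c r θ) :
    aSq c ε r = ENNReal.ofReal (1 / (2 * ε ^ 4) * ∑' i, θ i ^ 4) := by
  refine le_antisymm (iInf₂_le θ h.1) (le_iInf₂ fun θ' hθ' => ?_)
  refine ENNReal.ofReal_le_ofReal (mul_le_mul_of_nonneg_left (h.2 θ' hθ') ?_)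
  have : 0 ≤ ε ^ 4 := by positivity
  positivity

lemma ofReal_rpow_half {s : ℝ} (hs : 0 ≤ s) :
    ENNReal.ofReal s ^ (1 / 2 : ℝ) = ENNReal.ofReal (√s) := by
  rw [ENNReal.ofReal_rpow_of_nonneg hs (by norm_num), Real.sqrt_eq_rpow]

lemma aVal_anti {r r' : ℝ} (hr : 0 ≤ r) (hrr : r ≤ r') : aVal c ε r ≤ aVal c ε r' := by
  refine ENNReal.rpow_le_rpow ?_ (by norm_num)
  refine le_iInf₂ fun θ hθ => iInf₂_le θ ?_
  exact ⟨hθ.1, hθ.2.1, hθ.2.2.1, (pow_le_pow_left₀ hr hrr 2).trans hθ.2.2.2⟩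

lemma aVal_comp_equiv {J : Type} (e : J ≃ I) : aVal (fun j => c (e j)) ε r = aVal c ε r := by
  have key : ∀ θ : I → ℝ, (fun j => θ (e j)) ∈ PuncturedEllipsoid (fun j => c (e j)) r ↔
      θ ∈ PuncturedEllipsoid c r := by
    intro θ
    simp only [PuncturedEllipsoid, Set.mem_ofPred_eq]
    rw [e.tsum_eq (fun i => θ i ^ 2), e.tsum_eq (fun i => θ i ^ 2 * c i ^ 2),
      ← e.summable_iff (f := fun i => θ i ^ 2),
      ← e.summable_iff (f := fun i => θ i ^ 2 * c i ^ 2)]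
    rfl
  unfold aVal aSq
  congr 1
  refine le_antisymm ?_ ?_
  · refine le_iInf₂ fun θ hθ => (iInf₂_le (fun j => θ (e j)) ((key θ).2 hθ)).trans ?_
    rw [e.tsum_eq (fun i => θ i ^ 4)]
  · refine le_iInf₂ fun θ hθ => ?_
    have hθ' : (fun j => θ j) = fun j => (fun i => θ (e.symm i)) (e j) := by
      funext j; simp
    have h1 := (key fun i => θ (e.symm i)).1 (hθ' ▸ hθ)
    refine (iInf₂_le _ h1).trans ?_
    rw [e.symm.tsum_eq (fun i => θ i ^ 4)]

/-- `rStar` is a choice among the solutions and means something only if one exists; `√R` is one. -/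
lemma rStar_spec {a : ℝ} (hε : 0 < ε) (ha : 0 < a) {R : ℝ} {x : I → ℝ} (hR : 0 < R)
    (hx : IsLeast2 c R x) (hxa : ∑' i, x i ^ 2 = 2 * ε ^ 4 * a ^ 2) :
    0 < rStar c ε a ∧ aVal c ε (rStar c ε a) = ENNReal.ofReal a := by
  refine Classical.epsilon_spec (p := fun r : ℝ => 0 < r ∧ aVal c ε r = ENNReal.ofReal a)
    ⟨√R, Real.sqrt_pos.2 hR, ?_⟩
  have hx' : IsLeast2 c (√R ^ 2) x := by rwa [Real.sq_sqrt hR.le]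
  have h1 := hx'.isExtremal_sqrt
  rw [aVal, h1.aSq_eq, tsum_pow_four]
  simp only [Real.sq_sqrt (Feasible.nonneg hx.1 _)]
  rw [hxa, ofReal_rpow_half (by positivity)]
  congr 1
  rw [show 1 / (2 * ε ^ 4) * (2 * ε ^ 4 * a ^ 2) = a ^ 2 by field_simp, Real.sqrt_sq ha.le]

/-- The squares of the extremal sequence for a radius with `a(r) = a`. -/
lemma thetaStar_spec {a : ℝ} (hc : ∀ i, 0 < c i) (hfin : ∀ K, {i | c i ≤ K}.Finite)
    (hε : 0 < ε) (ha : 0 < a) (hr : aVal c ε r = ENNReal.ofReal a) :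
    IsLeast2 c (r ^ 2) (fun i => thetaStar c r i ^ 2) ∧
      ∑' i, (thetaStar c r i ^ 2) ^ 2 = 2 * ε ^ 4 * a ^ 2 ∧
      ∀ i, weight c ε r i = thetaStar c r i ^ 2 / (2 * ε ^ 2 * a) := by
  have hne : (PuncturedEllipsoid c r).Nonempty := by
    by_contra hemp
    rw [Set.not_nonempty_iff_eq_empty] at hemp
    have : aVal c ε r = ⊤ := by simp [aVal, aSq, hemp]
    rw [hr] at this
    exact ENNReal.ofReal_ne_top this
  obtain ⟨θ, hθ⟩ := hne
  obtain ⟨x, hx⟩ := exists_isLeast2 hc hfin ⟨_, mem_puncturedEllipsoid_iff.1 hθ⟩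
  have hex : IsExtremal c r (thetaStar c r) :=
    Classical.epsilon_spec (p := IsExtremal c r) ⟨_, hx.isExtremal_sqrt⟩
  refine ⟨hex.isLeast2, ?_, fun i => ?_⟩
  · have h4 : 0 ≤ ∑' i, (thetaStar c r i ^ 2) ^ 2 := tsum_nonneg fun i => sq_nonneg _
    rw [aVal, hex.aSq_eq, tsum_pow_four, ofReal_rpow_half (by positivity),
      ENNReal.ofReal_eq_ofReal_iff (Real.sqrt_nonneg _) ha.le,
      Real.sqrt_eq_iff_mul_self_eq (by positivity) ha.le] at hr
    field_simp at hr
    rw [← tsum_pow_four, hr]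
  · rw [weight, hr, ENNReal.toReal_ofReal ha.le]
    field_simp

/-- The properties of the weights which the analysis of the statistics uses. -/
structure GoodWeight (c : I → ℝ) (ε a W r : ℝ) (ω : I → ℝ) : Prop where
  nonneg : ∀ i, 0 ≤ ω i
  le : ∀ i, ω i ≤ W
  finite : ω.support.Finite
  tsum_sq : ∑' i, ω i ^ 2 = 1 / 2
  le_mean : ∀ θ ∈ PuncturedEllipsoid c r, a ≤ ∑' i, ω i * (θ i / ε) ^ 2

/-- As `ω` is `x / (2 * ε ^ 2 * a)` with `x` the least element and `∑ x ^ 2 = 2 * ε ^ 4 * a ^ 2`,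
the field `le_mean` is the variational inequality rescaled. The hypothesis `hW` is `ω i ≤ W`,
squared and cleared of denominators. -/
lemma goodWeight {a W : ℝ} [Infinite I] (hc : ∀ i, 0 < c i)
    (hfin : ∀ K, {i | c i ≤ K}.Finite) (hε : 0 < ε) (ha : 0 < a) (hr0 : 0 < r)
    (hr : aVal c ε r = ENNReal.ofReal a) (hW0 : 0 ≤ W)
    (hW : ∀ x, IsLeast2 c (r ^ 2) x → ∑' i, x i ^ 2 = 2 * ε ^ 4 * a ^ 2 →
      ∀ i, x i ^ 2 ≤ W ^ 2 * (4 * ε ^ 4 * a ^ 2)) :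
    GoodWeight c ε a W r (weight c ε r) := by
  obtain ⟨h1, h2, h3⟩ := thetaStar_spec hc hfin hε ha hr
  have hD : 0 < 2 * ε ^ 2 * a := by positivity
  refine ⟨fun i => ?_, fun i => ?_, ?_, ?_, fun θ hθ => ?_⟩
  · rw [h3]; positivity
  · rw [h3, div_le_iff₀ hD]
    refine abs_le_of_sq_le_sq' ?_ (by positivity) |>.2
    refine (hW _ h1 h2 i).trans (le_of_eq (by ring))
  · refine (h1.finite_support (by positivity) hfin fun i => (hc i).le).subset fun i hi => ?_
    contrapose! hi
    simp only [Function.mem_support, not_not] at hi ⊢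
    rw [h3, hi, zero_div]
  · have : ∀ i, weight c ε r i ^ 2 = 1 / (4 * ε ^ 4 * a ^ 2) * (thetaStar c r i ^ 2) ^ 2 := by
      intro i; rw [h3]; field_simp; ring
    rw [tsum_congr this, tsum_mul_left, h2]
    field_simp
    norm_num
  · have h4 := h1.le_tsum_mul (mem_puncturedEllipsoid_iff.1 hθ)
    rw [h2] at h4
    have : ∀ i, weight c ε r i * (θ i / ε) ^ 2
        = 1 / (2 * ε ^ 4 * a) * (thetaStar c r i ^ 2 * θ i ^ 2) := by
      intro i; rw [h3]; field_simp
    rw [tsum_congr this, tsum_mul_left]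
    calc a = 1 / (2 * ε ^ 4 * a) * (2 * ε ^ 4 * a ^ 2) := by field_simp
      _ ≤ _ := by gcongr

end ExtremalFunction

/-! ### Counting frequencies with bounded Sobolev coefficient, and invariance in `u`. -/

section Frequencies

variable {σ : ℝ} {d k : ℕ} {u : Finset (Fin d)}

lemma card_pos_exists (hk : 1 ≤ k) (hu : u.card = k) : ∃ j, j ∈ u :=
  Finset.card_pos.1 (by omega)

lemma sum_sq_pos (hk : 1 ≤ k) (hu : u.card = k) (l : Freq u) :
    0 < ∑ j, (2 * Real.pi * (l.1 j : ℝ)) ^ 2 := by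
  obtain ⟨j, hj⟩ := card_pos_exists hk hu
  have hl : (l.1 j : ℝ) ≠ 0 := by exact_mod_cast (l.2 j).2 hj
  refine Finset.sum_pos' (fun i _ => sq_nonneg _) ⟨j, Finset.mem_univ _, ?_⟩
  have := Real.pi_pos
  positivity

lemma coeff_pos (hk : 1 ≤ k) (hu : u.card = k) (l : Freq u) : 0 < coeff σ u l :=
  Real.rpow_pos_of_pos (sum_sq_pos hk hu l) _

lemma coeff_le_of_abs_le (hk : 1 ≤ k) (hσ : 0 < σ) (hu : u.card = k) (l : Freq u) {n : ℝ}
    (hl : ∀ j ∈ u, |(l.1 j : ℝ)| ≤ n) :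
    coeff σ u l ≤ (k * (2 * Real.pi * n) ^ 2) ^ (σ / 2) := by
  refine Real.rpow_le_rpow (sum_sq_pos hk hu l).le ?_ (by positivity)
  have h1 : ∑ j, (2 * Real.pi * (l.1 j : ℝ)) ^ 2 = ∑ j ∈ u, (2 * Real.pi * (l.1 j : ℝ)) ^ 2 := by
    refine (Finset.sum_subset (Finset.subset_univ u) fun j _ hj => ?_).symm
    have : l.1 j = 0 := by
      by_contra h
      exact hj ((l.2 j).1 h)
    simp [this]
  rw [h1, ← hu, ← nsmul_eq_mul]
  refine Finset.sum_le_card_nsmul _ _ _ fun j hj => ?_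
  rw [mul_pow, mul_pow _ n]
  refine mul_le_mul_of_nonneg_left ?_ (sq_nonneg _)
  rw [← sq_abs]
  exact pow_le_pow_left₀ (abs_nonneg _) (hl j hj) 2

lemma abs_le_of_coeff_le (hσ : 0 < σ) (l : Freq u) {K : ℝ}
    (hl : coeff σ u l ≤ K) (j : Fin d) : |l.1 j| ≤ ⌊K ^ (1 / σ)⌋₊ := by
  have hS : (0 : ℝ) ≤ ∑ j, (2 * Real.pi * (l.1 j : ℝ)) ^ 2 :=
    Finset.sum_nonneg fun i _ => sq_nonneg _
  have h1 : (∑ j, (2 * Real.pi * (l.1 j : ℝ)) ^ 2) ^ (1 / 2 : ℝ) ≤ K ^ (1 / σ) := by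
    have := Real.rpow_le_rpow (Real.rpow_nonneg hS _) hl (z := 1 / σ) (by positivity)
    rw [← Real.rpow_mul hS] at this
    convert this using 2
    field_simp
  have h2 : |(l.1 j : ℝ)| ≤ K ^ (1 / σ) := by
    refine le_trans ?_ h1
    rw [← Real.sqrt_eq_rpow]
    refine Real.le_sqrt_of_sq_le ?_
    refine le_trans ?_ (Finset.single_le_sum (f := fun j => (2 * Real.pi * (l.1 j : ℝ)) ^ 2)
      (fun i _ => sq_nonneg _) (Finset.mem_univ j))
    rw [sq_abs, mul_pow]
    have : 1 ≤ (2 * Real.pi) ^ 2 := one_le_pow₀ (by linarith [Real.pi_gt_three])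
    nlinarith [sq_nonneg (l.1 j : ℝ)]
  have h3 : ((|l.1 j|.toNat : ℕ) : ℝ) ≤ K ^ (1 / σ) := by
    refine le_trans (le_of_eq ?_) h2
    rw [← Int.cast_abs]
    exact_mod_cast congrArg (Int.cast (R := ℝ)) (Int.toNat_of_nonneg (abs_nonneg (l.1 j)))
  have h4 := Nat.le_floor h3
  omega

open Classical in
-- A bound on the coefficient bounds every coordinate, so the frequencies embed into a box of
-- dimension `k`.
lemma exists_finset_coeff_le (hσ : 0 < σ) (hu : u.card = k) (K : ℝ) :
    ∃ J : Finset (Freq u), (∀ l, coeff σ u l ≤ K ↔ l ∈ J) ∧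
      J.card ≤ (2 * ⌊K ^ (1 / σ)⌋₊ + 1) ^ k := by
  set n := ⌊K ^ (1 / σ)⌋₊ with hn
  let T : Finset (u → ℤ) := Fintype.piFinset fun _ => Finset.Icc (-(n : ℤ)) n
  let f : Freq u → (u → ℤ) := fun l j => l.1 j
  have hf : Function.Injective f := by
    intro l l' h
    refine Subtype.ext (funext fun j => ?_)
    by_cases hj : j ∈ u
    · exact congrFun h ⟨j, hj⟩
    · have h1 : ∀ l : Freq u, l.1 j = 0 := fun l => by
        by_contra h
        exact hj ((l.2 j).1 h)
      rw [h1, h1]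
  have hmaps : ∀ l ∈ {l : Freq u | coeff σ u l ≤ K}, f l ∈ T := by
    intro l hl
    refine Fintype.mem_piFinset.2 fun j => ?_
    have := abs_le.1 (abs_le_of_coeff_le hσ l hl j)
    exact Finset.mem_Icc.2 this
  have hfin : {l : Freq u | coeff σ u l ≤ K}.Finite :=
    Set.Finite.of_finite_image (T.finite_toSet.subset (Set.image_subset_iff.2 hmaps)) hf.injOn
  refine ⟨hfin.toFinset, fun l => by simp, ?_⟩
  calc hfin.toFinset.card ≤ T.card :=
        Finset.card_le_card_of_injOn f (fun l hl => hmaps l (by simpa using hl)) hf.injOn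
    _ = (2 * n + 1) ^ k := by
        simp only [T, Fintype.card_piFinset, Int.card_Icc, Finset.prod_const, Finset.card_univ,
          Fintype.card_coe, hu]
        congr 1
        omega

lemma finite_coeff_le (hσ : 0 < σ) (K : ℝ) : {l : Freq u | coeff σ u l ≤ K}.Finite := by
  obtain ⟨J, hJ, -⟩ := exists_finset_coeff_le hσ (u := u) rfl K
  exact J.finite_toSet.subset fun l hl => (hJ l).1 hl

/-- The frequency with entry `n + 1` at `j₀` and `1` elsewhere on `u`. -/
def spike (u : Finset (Fin d)) (j₀ : Fin d) (n : ℕ) : Freq u :=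
  ⟨fun j => if j ∈ u then (if j = j₀ then (n : ℤ) + 1 else 1) else 0, fun j => by
    by_cases hj : j ∈ u
    · simp only [hj, if_true, iff_true]
      split_ifs <;> omega
    · simp [hj]⟩

lemma spike_injective {j₀ : Fin d} (hj₀ : j₀ ∈ u) : Function.Injective (spike u j₀) := by
  intro n m h
  have := congrFun (Subtype.ext_iff.1 h) j₀
  simpa [spike, hj₀] using this

lemma infinite_freq (hk : 1 ≤ k) (hu : u.card = k) : Infinite (Freq u) := by
  obtain ⟨j, hj⟩ := card_pos_exists hk hu
  exact Infinite.of_injective _ (spike_injective hj)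

/-- Frequencies along one line suffice: the smallness of the weights is needed only with some
positive exponent, not the sharp one. -/
lemma exists_finset_card_eq (hk : 1 ≤ k) (hσ : 0 < σ) (hu : u.card = k) (n : ℕ) :
    ∃ J : Finset (Freq u), J.card = n ∧
      ∀ l ∈ J, coeff σ u l ≤ (k * (2 * Real.pi * n) ^ 2) ^ (σ / 2) := by
  obtain ⟨j₀, hj₀⟩ := card_pos_exists hk hu
  refine ⟨(Finset.range n).map ⟨spike u j₀, spike_injective hj₀⟩, by simp, fun l hl => ?_⟩
  obtain ⟨m, hm, rfl⟩ := Finset.mem_map.1 hl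
  have hm := Finset.mem_range.1 hm
  refine coeff_le_of_abs_le hk hσ hu _ fun j hj => ?_
  have : |(spike u j₀ m).1 j| ≤ (n : ℤ) := by
    simp only [spike, hj, if_true]
    rw [abs_le]
    split_ifs <;> omega
  exact_mod_cast this

open Classical in
/-- The reindexing of the frequencies of `u` by those of the full set of `k` coordinates. -/
lemma exists_freq_equiv (hu : u.card = k) :
    ∃ e : Freq u ≃ Freq (Finset.univ : Finset (Fin k)),
      ∀ l, coeff σ Finset.univ (e l) = coeff σ u l := by
  let f : Fin k ≃ u := (u.equivFinOfCardEq hu).symm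
  refine ⟨⟨fun l => ⟨fun i => l.1 (f i), fun i => by simp [l.2]⟩,
    fun l => ⟨fun j => if h : j ∈ u then l.1 (f.symm ⟨j, h⟩) else 0, fun j => ?_⟩,
    fun l => ?_, fun l => ?_⟩, fun l => ?_⟩
  · by_cases h : j ∈ u
    · simp only [h, dif_pos, iff_true]
      exact (l.2 _).2 (Finset.mem_univ _)
    · simp [h]
  · refine Subtype.ext (funext fun j => ?_)
    by_cases h : j ∈ u
    · simp [h]
    · have : l.1 j = 0 := by
        by_contra h'
        exact h ((l.2 j).1 h')
      simp [h, this]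
  · exact Subtype.ext (funext fun i => by simp)
  · simp only [coeff, Equiv.coe_fn_mk]
    congr 1
    rw [f.sum_comp (fun j : u => (2 * Real.pi * (l.1 j : ℝ)) ^ 2),
      Finset.sum_coe_sort u (fun j => (2 * Real.pi * (l.1 j : ℝ)) ^ 2)]
    refine Finset.sum_subset (Finset.subset_univ u) fun j _ hj => ?_
    have : l.1 j = 0 := by
      by_contra h
      exact hj ((l.2 j).1 h)
    simp [this]

lemma aK_eq_aVal (hu : u.card = k) (ε r : ℝ) : aK σ ε k r = aVal (coeff σ u) ε r := by
  obtain ⟨e, he⟩ := exists_freq_equiv (σ := σ) hu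
  rw [aK, ← aVal_comp_equiv e]
  simp only [he]

end Frequencies
-- Polynomial bounds for the extremal value and the weights.
section Polynomial

variable {σ : ℝ} {k : ℕ}

/-- Apply `Feasible.sq_le` at the cutoff `K ^ 2 = 2 / R`, where the box count is a power of `R⁻¹`.
It shows that a small extremal value forces a small radius. -/
lemma rpow_le_tsum_sq (hσ : 0 < σ) {d : ℕ} {u : Finset (Fin d)} (hu : u.card = k) {R : ℝ}
    (hR : 0 < R) (hR1 : R ≤ 1) {x : Freq u → ℝ} (hx : x ∈ Feasible (coeff σ u) R) :
    R ^ (2 + k / (2 * σ)) ≤ 4 * (3 ^ k * 2 ^ (k / (2 * σ))) * ∑' i, x i ^ 2 := by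
  set K := √(2 / R) with hK
  have hK2 : K ^ 2 = 2 / R := Real.sq_sqrt (by positivity)
  have hK0 : 0 < K := by positivity
  have hK1 : 1 ≤ K := by
    rw [hK, Real.one_le_sqrt, le_div_iff₀ hR]
    linarith
  obtain ⟨J, hJ, hcard⟩ := exists_finset_coeff_le hσ hu K
  have h1 := Feasible.sq_le hx hR.le hK0 (by rw [hK2]; field_simp; rfl) J
    fun j hj => (not_le.1 ((hJ j).not.2 hj)).le
  have hX : 0 ≤ ∑' i, x i ^ 2 := tsum_nonneg fun i => sq_nonneg _
  have h2 : (J.card : ℝ) ≤ 3 ^ k * (2 / R) ^ (k / (2 * σ)) := by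
    have hKσ : 1 ≤ K ^ (1 / σ) := Real.one_le_rpow hK1 (by positivity)
    have h3 : ((⌊K ^ (1 / σ)⌋₊ : ℕ) : ℝ) ≤ K ^ (1 / σ) := Nat.floor_le (by positivity)
    calc (J.card : ℝ) ≤ ((2 * ⌊K ^ (1 / σ)⌋₊ + 1) ^ k : ℕ) := by exact_mod_cast hcard
      _ = (2 * (⌊K ^ (1 / σ)⌋₊ : ℝ) + 1) ^ k := by push_cast; rfl
      _ ≤ (3 * K ^ (1 / σ)) ^ k := by gcongr; linarith
      _ = 3 ^ k * (K ^ (1 / σ)) ^ k := mul_pow _ _ _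
      _ = 3 ^ k * (2 / R) ^ (k / (2 * σ)) := by
        congr 1
        rw [hK, Real.sqrt_eq_rpow, ← Real.rpow_mul (by positivity), ← Real.rpow_natCast,
          ← Real.rpow_mul (by positivity)]
        congr 1
        field_simp
  have h4 : R ^ 2 ≤ 4 * (3 ^ k * (2 / R) ^ (k / (2 * σ))) * ∑' i, x i ^ 2 :=
    h1.trans (by gcongr)
  rw [Real.rpow_add hR, Real.rpow_two]
  rw [Real.div_rpow (by norm_num) hR.le] at h4
  have hp : 0 < R ^ (k / (2 * σ)) := by positivity
  calc R ^ 2 * R ^ (k / (2 * σ))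
      ≤ (4 * (3 ^ k * (2 ^ (k / (2 * σ)) / R ^ (k / (2 * σ)))) * ∑' i, x i ^ 2)
        * R ^ (k / (2 * σ)) := by gcongr
    _ = _ := by field_simp

/-- For small `R` many frequencies satisfy `c ^ 2 * R ≤ 1 / 2`, and the least element must spread
over them (`IsLeast2.sq_mul_card_le`). -/
lemma IsLeast2.sq_le_rpow (hk : 1 ≤ k) (hσ : 0 < σ) {d : ℕ} {u : Finset (Fin d)}
    (hu : u.card = k) {R : ℝ} (hR : 0 < R) {x : Freq u → ℝ} (hx : IsLeast2 (coeff σ u) R x)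
    (i : Freq u) :
    x i ^ 2 ≤ 8 * (2 * Real.pi * √k) * (2 * R) ^ (1 / (2 * σ)) * ∑' i, x i ^ 2 := by
  have hk0 : (0 : ℝ) < k := by exact_mod_cast hk
  have hpi := Real.pi_pos
  -- `y` solves `(k * (2 * π * y) ^ 2) ^ σ = 1 / (2 * R)`: up to its integer part the coefficients
  -- stay within the admissible cutoff. If `y < 1` there are no such frequencies, but then the
  -- claimed factor `8 / y` exceeds one.
  set y := (1 / (2 * R)) ^ (1 / (2 * σ)) / (2 * Real.pi * √k) with hy
  have hy0 : 0 < y := by positivity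
  have hX : 0 ≤ ∑' i, x i ^ 2 := tsum_nonneg fun i => sq_nonneg _
  have hyinv : 8 * (2 * Real.pi * √k) * (2 * R) ^ (1 / (2 * σ)) = 8 / y := by
    rw [hy, Real.div_rpow (by norm_num) (by positivity), Real.one_rpow]
    field_simp
  rw [hyinv]
  rcases lt_or_ge y 1 with hy1 | hy1
  · have h1 : x i ^ 2 ≤ ∑' i, x i ^ 2 :=
      (Feasible.summable_sq hx.1).le_tsum i fun j _ => sq_nonneg _
    have h2 : 1 ≤ 8 / y := by rw [le_div_iff₀ hy0]; linarith
    exact h1.trans (le_mul_of_one_le_left hX h2)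
  set n := ⌊y⌋₊ with hn
  have hny : (n : ℝ) ≤ y := Nat.floor_le hy0.le
  have hny' : y < n + 1 := Nat.lt_floor_add_one y
  have hn1 : 1 ≤ n := Nat.le_floor (by simpa using hy1)
  have hn1' : (1 : ℝ) ≤ n := by exact_mod_cast hn1
  obtain ⟨J, hJ, hJc⟩ := exists_finset_card_eq hk hσ hu n
  have hKR : ((k * (2 * Real.pi * n) ^ 2) ^ (σ / 2)) ^ 2 * R ≤ 1 / 2 := by
    have h1 : ((k * (2 * Real.pi * n) ^ 2) ^ (σ / 2)) ^ 2 ≤ 1 / (2 * R) := by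
      calc (((k : ℝ) * (2 * Real.pi * n) ^ 2) ^ (σ / 2)) ^ 2
          ≤ ((k * (2 * Real.pi * y) ^ 2) ^ (σ / 2)) ^ 2 := by gcongr
        _ = (((1 / (2 * R)) ^ (1 / (2 * σ))) ^ 2) ^ σ := by
          rw [← Real.rpow_natCast, ← Real.rpow_mul (by positivity)]
          congr 1
          · rw [hy]
            have : √(k : ℝ) ^ 2 = k := Real.sq_sqrt hk0.le
            field_simp
            rw [this]
          · push_cast; ring
        _ = 1 / (2 * R) := by
          rw [← Real.rpow_natCast, ← Real.rpow_mul (by positivity),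
            ← Real.rpow_mul (by positivity)]
          convert Real.rpow_one _ using 2
          push_cast
          field_simp
    calc _ ≤ 1 / (2 * R) * R := by gcongr
      _ = 1 / 2 := by field_simp
  have h1 := hx.sq_mul_card_le hR.le (K := (k * (2 * Real.pi * n) ^ 2) ^ (σ / 2)) (by positivity)
    hKR J (fun l hl => ⟨(coeff_pos hk hu l).le, hJc l hl⟩) i
  rw [hJ] at h1
  rw [div_mul_eq_mul_div, le_div_iff₀ hy0]
  nlinarith [sq_nonneg (x i)]

/-- Constants, depending on `k` and `σ` only, such that for small values of the extremal problem
the level is attained and the weights are small. -/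
lemma exists_goodWeight (hk : 1 ≤ k) (hσ : 0 < σ) :
    ∃ C κ v₀ : ℝ, 0 < C ∧ 0 < κ ∧ 0 < v₀ ∧ ∀ (d : ℕ) (u : Finset (Fin d)), u.card = k →
      ∀ ε a : ℝ, 0 < ε → 0 < a → 2 * ε ^ 4 * a ^ 2 < v₀ →
        0 < rStar (coeff σ u) ε a ∧
        aVal (coeff σ u) ε (rStar (coeff σ u) ε a) = ENNReal.ofReal a ∧
        GoodWeight (coeff σ u) ε a (C * (2 * ε ^ 4 * a ^ 2) ^ κ) (rStar (coeff σ u) ε a)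
          (weight (coeff σ u) ε (rStar (coeff σ u) ε a)) := by
  have hk0 : (0 : ℝ) < k := by exact_mod_cast hk
  have hpi := Real.pi_pos
  set q : ℝ := 2 + k / (2 * σ) with hq
  have hq0 : 0 < q := by positivity
  set C₁ : ℝ := 4 * (3 ^ k * 2 ^ (k / (2 * σ))) with hC₁
  have hC₁0 : 0 < C₁ := by positivity
  set D : ℝ := (k * (2 * Real.pi) ^ 2) ^ σ with hD
  have hD1 : 1 ≤ D := by
    refine Real.one_le_rpow ?_ hσ.le
    have h1 : 1 ≤ (2 * Real.pi) ^ 2 := one_le_pow₀ (by linarith [Real.pi_gt_three])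
    have h2 : (1 : ℝ) ≤ k := by exact_mod_cast hk
    nlinarith
  set R₀ : ℝ := 1 / (2 * D) with hR₀
  have hR₀0 : 0 < R₀ := by positivity
  have hR₀1 : R₀ ≤ 1 := by rw [hR₀, div_le_one (by positivity)]; linarith
  set κ' : ℝ := 1 / (2 * σ) / q with hκ'
  set C' : ℝ := 8 * (2 * Real.pi * √k) * (2 * C₁ ^ (1 / q)) ^ (1 / (2 * σ)) with hC'
  have hκ'0 : 0 < κ' := by positivity
  have hC'0 : 0 < C' := by positivity
  -- The square root and the half exponent arise because `W` enters squared. In the bound on `v`, `1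
  -- / (2 * C₁)` forces the radius below one, and `R₀ ^ q / C₁` puts `v` below the extremal value at
  -- `R₀`, so that the level is attained.
  refine ⟨√(C' / 2), κ' / 2, min (1 / (2 * C₁)) (R₀ ^ q / C₁), by positivity, by positivity,
    by positivity, fun d u hu ε a hε ha hv => ?_⟩
  have hinf := infinite_freq hk hu
  have hc := coeff_pos (σ := σ) hk hu
  have hfin := finite_coeff_le (u := u) hσ
  set v := 2 * ε ^ 4 * a ^ 2 with hv'
  have hv0 : 0 < v := by positivity
  obtain ⟨R, x, hR, -, hx, hxv⟩ : ∃ R x, 0 < R ∧ R ≤ R₀ ∧ IsLeast2 (coeff σ u) R x ∧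
      ∑' i, x i ^ 2 = v := by
    obtain ⟨J, hJ, hJc⟩ := exists_finset_card_eq hk hσ hu 1
    obtain ⟨l, hl⟩ := Finset.card_pos.1 (by omega : 0 < J.card)
    refine exists_isLeast2_eq hc hfin (i₀ := l) hR₀0 ?_ hv0 fun x hx => ?_
    · have h1 : coeff σ u l ^ 2 ≤ D := by
        calc coeff σ u l ^ 2 ≤ ((k * (2 * Real.pi * (1 : ℕ)) ^ 2) ^ (σ / 2)) ^ 2 :=
              pow_le_pow_left₀ (hc l).le (hJc l hl) 2
          _ = D := by
            rw [← Real.rpow_natCast, ← Real.rpow_mul (by positivity), hD]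
            norm_num
      calc R₀ * coeff σ u l ^ 2 ≤ R₀ * D := by gcongr
        _ = 1 / 2 := by rw [hR₀]; field_simp
        _ < 1 := by norm_num
    · have h1 := rpow_le_tsum_sq hσ hu hR₀0 hR₀1 hx
      refine (hv.trans_le (min_le_right _ _)).trans_le ?_
      rwa [div_le_iff₀' hC₁0]
  obtain ⟨hr0, hr⟩ := rStar_spec hε ha hR hx hxv
  refine ⟨hr0, hr, goodWeight hc hfin hε ha hr0 hr (by positivity) fun x hx hxv i => ?_⟩
  rw [mul_pow, Real.sq_sqrt (by positivity)]
  set R := rStar (coeff σ u) ε a ^ 2 with hRdef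
  have hR : 0 < R := by positivity
  have hXv : ∑' i, x i ^ 2 = v := hxv
  have hR1 : R ^ q ≤ C₁ * v := by
    -- Nothing is known in advance about the size of the chosen radius; its least element is also
    -- feasible for the truncation at one, where the polynomial bound applies.
    have hmin : min R 1 ^ q ≤ C₁ * v := by
      rw [← hXv]
      exact rpow_le_tsum_sq hσ hu (by positivity) (min_le_right _ _)
        (Feasible.anti (min_le_left _ _) hx.1)
    have hlt : min R 1 < 1 := by
      by_contra! h1
      have h2 : 1 ≤ min R 1 ^ q := Real.one_le_rpow h1 hq0.le
      have h3 := hv.trans_le (min_le_left _ _)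
      rw [lt_div_iff₀ (by positivity)] at h3
      linarith
    rwa [min_eq_left (by by_contra! h; rw [min_eq_right h.le] at hlt; exact lt_irrefl _ hlt)]
      at hmin
  have hR2 : R ≤ (C₁ * v) ^ (1 / q) := by
    have := Real.rpow_le_rpow (by positivity) hR1 (z := 1 / q) (by positivity)
    rwa [← Real.rpow_mul hR.le, mul_one_div_cancel hq0.ne', Real.rpow_one] at this
  have h5 : (2 * R) ^ (1 / (2 * σ)) ≤ (2 * C₁ ^ (1 / q)) ^ (1 / (2 * σ)) * v ^ κ' := by
    calc (2 * R) ^ (1 / (2 * σ)) ≤ (2 * (C₁ * v) ^ (1 / q)) ^ (1 / (2 * σ)) := by gcongr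
      _ = _ := by
        rw [Real.mul_rpow hC₁0.le hv0.le, ← mul_assoc, Real.mul_rpow (by positivity)
          (by positivity), ← Real.rpow_mul hv0.le]
        congr 2
        rw [hκ']; ring
  calc x i ^ 2 ≤ 8 * (2 * Real.pi * √k) * (2 * R) ^ (1 / (2 * σ)) * ∑' i, x i ^ 2 :=
        hx.sq_le_rpow hk hσ hu hR i
    _ ≤ 8 * (2 * Real.pi * √k) * ((2 * C₁ ^ (1 / q)) ^ (1 / (2 * σ)) * v ^ κ') * v := by
        rw [hXv]; gcongr
    _ = C' * v ^ κ' * v := by rw [hC']; ring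
    _ = C' / 2 * (v ^ (κ' / 2)) ^ 2 * (4 * ε ^ 4 * a ^ 2) := by
        rw [← Real.rpow_natCast (v ^ (κ' / 2)), ← Real.rpow_mul hv0.le]
        have : κ' / 2 * ((2 : ℕ) : ℝ) = κ' := by push_cast; ring
        rw [this, hv']
        ring

end Polynomial
-- Exponential moments and tails of weighted chi-square sums.
section Gaussian

/-- Completing the square; it yields both integrability and the value of the exponential moment. -/
lemma gaussian_quadratic_eq (s μ x : ℝ) (hs : 0 < 1 + 2 * s) :
    gaussianPDFReal 0 1 x * Real.exp (-(s * (x + μ) ^ 2)) =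
      ((√(2 * Real.pi))⁻¹ * Real.exp (-(s * μ ^ 2 / (1 + 2 * s)))) *
        Real.exp (-((1 + 2 * s) / 2) * (x + 2 * s * μ / (1 + 2 * s)) ^ 2) := by
  simp only [gaussianPDFReal, NNReal.coe_one, mul_one, sub_zero]
  rw [mul_assoc, mul_assoc, ← Real.exp_add, ← Real.exp_add]
  congr 2
  field_simp
  ring

lemma integrable_exp_quadratic (s μ : ℝ) (hs : 0 < 1 + 2 * s) :
    Integrable (fun x => Real.exp (-(s * (x + μ) ^ 2))) (gaussianReal 0 1) := by
  rw [gaussianReal_of_var_ne_zero _ one_ne_zero,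
    integrable_withDensity_iff_integrable_smul' (measurable_gaussianPDF _ _)
      (ae_of_all _ fun _ => gaussianPDF_lt_top)]
  have h1 : ∀ x, (gaussianPDF 0 1 x).toReal • Real.exp (-(s * (x + μ) ^ 2)) = _ := fun x => by
    rw [toReal_gaussianPDF, smul_eq_mul, gaussian_quadratic_eq s μ x hs]
  simp only [h1]
  exact ((integrable_exp_neg_mul_sq (by positivity)).comp_add_right _).const_mul _

lemma integral_exp_quadratic (s μ : ℝ) (hs : 0 < 1 + 2 * s) :
    ∫ x, Real.exp (-(s * (x + μ) ^ 2)) ∂gaussianReal 0 1 =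
      (√(1 + 2 * s))⁻¹ * Real.exp (-(s * μ ^ 2 / (1 + 2 * s))) := by
  rw [integral_gaussianReal_eq_integral_smul one_ne_zero]
  simp only [smul_eq_mul, gaussian_quadratic_eq s μ _ hs]
  rw [integral_const_mul, integral_add_right_eq_self
    (fun x => Real.exp (-((1 + 2 * s) / 2) * x ^ 2)), integral_gaussian]
  have h1 : Real.pi / ((1 + 2 * s) / 2) = 2 * Real.pi / (1 + 2 * s) := by field_simp
  rw [h1, Real.sqrt_div (by positivity)]
  have : √(2 * Real.pi) ≠ 0 := by positivity
  field_simp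

lemma inv_sqrt_le_exp {y B : ℝ} (hy : 0 < y) (h : -Real.log y ≤ 2 * B) :
    (√y)⁻¹ ≤ Real.exp B := by
  rw [← Real.exp_log (Real.sqrt_pos.2 hy), ← Real.exp_neg, Real.exp_le_exp,
    Real.log_sqrt hy.le]
  linarith

/-- `-log (1 - x) ≤ x + x² / (2 (1 - x))`. -/
lemma neg_log_one_sub_le {x : ℝ} (h0 : 0 ≤ x) (h1 : x < 1) :
    -Real.log (1 - x) ≤ x + x ^ 2 / (2 * (1 - x)) := by
  have hd : ∀ y ∈ Set.Ico (0 : ℝ) 1, HasDerivAt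
      (fun y => y + y ^ 2 / (2 * (1 - y)) + Real.log (1 - y))
      (y ^ 2 / (2 * (1 - y) ^ 2)) y := by
    intro y hy
    have hy1 : 1 - y ≠ 0 := by have := hy.2; linarith
    have h2 : HasDerivAt (fun y : ℝ => 1 - y) (-1) y := by
      simpa using (hasDerivAt_id y).const_sub 1
    refine (((hasDerivAt_id y).add ((hasDerivAt_pow 2 y).div (h2.const_mul 2)
      (mul_ne_zero two_ne_zero hy1))).add (h2.log hy1)).congr_deriv ?_
    push_cast
    field_simp
    ring
  have hmono : MonotoneOn (fun y => y + y ^ 2 / (2 * (1 - y)) + Real.log (1 - y))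
      (Set.Ico (0 : ℝ) 1) := by
    refine monotoneOn_of_deriv_nonneg (convex_Ico 0 1)
      (fun y hy => (hd y hy).continuousAt.continuousWithinAt)
      (fun y hy => (hd y (interior_subset hy)).differentiableAt.differentiableWithinAt)
      fun y hy => ?_
    rw [(hd y (interior_subset hy)).deriv]
    positivity
  have := hmono ⟨le_rfl, one_pos⟩ ⟨h0, h1⟩ h0
  simp at this
  linarith

/-- `x - x² / 2 ≤ log (1 + x)` for `x ≥ 0`. -/
lemma sub_sq_half_le_log {x : ℝ} (h0 : 0 ≤ x) : x - x ^ 2 / 2 ≤ Real.log (1 + x) := by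
  have hd : ∀ y ∈ Set.Ici (0 : ℝ), HasDerivAt
      (fun y => Real.log (1 + y) - (y - y ^ 2 / 2)) (y ^ 2 / (1 + y)) y := by
    intro y hy
    have hy1 : 1 + y ≠ 0 := by have := Set.mem_Ici.1 hy; linarith
    have h2 : HasDerivAt (fun y : ℝ => 1 + y) 1 y := by
      simpa using (hasDerivAt_id y).const_add 1
    refine ((h2.log hy1).sub
      ((hasDerivAt_id y).sub ((hasDerivAt_pow 2 y).div_const 2))).congr_deriv ?_
    push_cast
    field_simp
    ring
  have hmono : MonotoneOn (fun y => Real.log (1 + y) - (y - y ^ 2 / 2)) (Set.Ici (0 : ℝ)) := by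
    refine monotoneOn_of_deriv_nonneg (convex_Ici 0)
      (fun y hy => (hd y hy).continuousAt.continuousWithinAt)
      (fun y hy => (hd y (interior_subset hy)).differentiableAt.differentiableWithinAt)
      fun y hy => ?_
    rw [(hd y (interior_subset hy)).deriv]
    have : 0 ≤ y := interior_subset hy
    positivity
  have := hmono (Set.self_mem_Ici) (Set.mem_Ici.2 h0) h0
  simp at this
  linarith

variable {ι : Type*} {I : Type*}

/-- The exponential moments of a weighted sum of shifted squares of independent normal variables. -/
lemma mgf_weighted_sum (f : I → ι) (hf : Function.Injective f) (J : Finset I) (ω μ : I → ℝ)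
    (t : ℝ) (ht : ∀ i ∈ J, 0 < 1 - 2 * (t * ω i)) :
    Integrable (fun ξ : ι → ℝ => Real.exp (t * ∑ i ∈ J, ω i * ((ξ (f i) + μ i) ^ 2 - 1)))
      (Measure.infinitePi fun _ => gaussianReal 0 1) ∧
    mgf (fun ξ : ι → ℝ => ∑ i ∈ J, ω i * ((ξ (f i) + μ i) ^ 2 - 1))
      (Measure.infinitePi fun _ => gaussianReal 0 1) t =
    ∏ i ∈ J, (Real.exp (-(t * ω i)) * ((√(1 - 2 * (t * ω i)))⁻¹ *
      Real.exp (t * ω i * μ i ^ 2 / (1 - 2 * (t * ω i))))) := by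
  set P : Measure (ι → ℝ) := Measure.infinitePi fun _ => gaussianReal 0 1
  set Y : I → (ι → ℝ) → ℝ := fun i ξ => ω i * ((ξ (f i) + μ i) ^ 2 - 1) with hY
  have hmeas : ∀ i, Measurable (Y i) := fun i => by fun_prop
  have hindep : iIndepFun Y P := by
    have h1 : iIndepFun (fun j (ξ : ι → ℝ) => ξ j) P :=
      iIndepFun_infinitePi (X := fun _ x => x) fun _ => measurable_id
    exact (h1.precomp hf).comp (fun i x => ω i * ((x + μ i) ^ 2 - 1)) fun i => by fun_prop
  have hsum : (fun ξ : ι → ℝ => ∑ i ∈ J, ω i * ((ξ (f i) + μ i) ^ 2 - 1)) = ∑ i ∈ J, Y i := by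
    funext ξ; simp [hY]
  have hfun : ∀ i, (fun x => Real.exp (t * (ω i * ((x + μ i) ^ 2 - 1)))) =
      fun x => Real.exp (-(t * ω i)) * Real.exp (-(-(t * ω i) * (x + μ i) ^ 2)) := by
    intro i; funext x
    rw [← Real.exp_add]; congr 1; ring
  have heval : ∀ j, MeasurePreserving (fun ξ : ι → ℝ => ξ j) P (gaussianReal 0 1) :=
    fun j => ⟨measurable_pi_apply j, Measure.infinitePi_map_eval _ j⟩
  have hint : ∀ i ∈ J, Integrable (fun ξ => Real.exp (t * Y i ξ)) P := by
    intro i hi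
    have h1 : Integrable (fun x => Real.exp (t * (ω i * ((x + μ i) ^ 2 - 1))))
        (gaussianReal 0 1) := by
      rw [hfun]
      exact (integrable_exp_quadratic _ _ (by linarith [ht i hi])).const_mul _
    exact (heval (f i)).integrable_comp_of_integrable h1
  have hmgf : ∀ i ∈ J, mgf (Y i) P t = Real.exp (-(t * ω i)) * ((√(1 - 2 * (t * ω i)))⁻¹ *
      Real.exp (t * ω i * μ i ^ 2 / (1 - 2 * (t * ω i)))) := by
    intro i hi
    have h1 : mgf (Y i) P t = ∫ x, Real.exp (t * (ω i * ((x + μ i) ^ 2 - 1))) ∂gaussianReal 0 1 := by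
      rw [← (heval (f i)).map_eq, integral_map (measurable_pi_apply _).aemeasurable
        (by fun_prop)]
      rfl
    rw [h1, hfun, integral_const_mul, integral_exp_quadratic _ _ (by linarith [ht i hi])]
    congr 3 <;> ring_nf
  constructor
  · have := hindep.integrable_exp_mul_sum hmeas hint
    rw [← hsum] at this
    exact this
  · rw [hsum, hindep.mgf_sum hmeas]
    exact Finset.prod_congr rfl hmgf

/-- Upper tail of a centred weighted chi-square sum with small weights. -/
lemma measure_lt_weighted_sum_le (f : I → ι) (hf : Function.Injective f) (J : Finset I)
    (ω : I → ℝ) {W t : ℝ} (hω : ∀ i, 0 ≤ ω i) (hW : ∀ i, ω i ≤ W)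
    (hsq : ∑ i ∈ J, ω i ^ 2 = 1 / 2) (ht : 0 ≤ t) (htW : 2 * t * W < 1) :
    (Measure.infinitePi fun _ : ι => gaussianReal 0 1).real
      {ξ | t < ∑ i ∈ J, ω i * (ξ (f i) ^ 2 - 1)} ≤
    Real.exp (-t ^ 2 + t ^ 2 / (2 * (1 - 2 * t * W))) := by
  have hle : ∀ i, t * ω i ≤ t * W := fun i => mul_le_mul_of_nonneg_left (hW i) ht
  obtain ⟨hint, hmgf⟩ := mgf_weighted_sum f hf J ω (fun _ => 0) t
    fun i _ => by linarith [hle i]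
  simp only [add_zero] at hint hmgf
  -- The Chernoff parameter is the threshold itself, the optimal choice for a standard normal
  -- variable.
  have h1 := measure_ge_le_exp_mul_mgf (μ := Measure.infinitePi fun _ : ι => gaussianReal 0 1)
    (X := fun ξ : ι → ℝ => ∑ i ∈ J, ω i * (ξ (f i) ^ 2 - 1)) t ht hint
  refine (measureReal_mono fun ξ hξ => (Set.mem_ofPred_eq ▸ hξ : _ < _).le).trans (h1.trans ?_)
  rw [hmgf, show -t ^ 2 + t ^ 2 / (2 * (1 - 2 * t * W)) =
    -t * t + ∑ i ∈ J, t ^ 2 * ω i ^ 2 / (1 - 2 * t * W) by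
      rw [← Finset.sum_div, ← Finset.mul_sum, hsq]
      have : 1 - 2 * t * W ≠ 0 := by linarith
      field_simp, Real.exp_add, Real.exp_sum]
  gcongr with i hi
  have hi0 : 0 ≤ t * ω i := mul_nonneg ht (hω i)
  have hi1 := hle i
  simp only [ne_eq, OfNat.ofNat_ne_zero, not_false_eq_true, zero_pow, mul_zero, zero_div,
    Real.exp_zero, mul_one]
  -- The linear term `t * ω i` cancels against the centring; the quadratic terms add up through `∑ ω
  -- ^ 2 = 1 / 2`.
  have h2 : (√(1 - 2 * (t * ω i)))⁻¹ ≤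
      Real.exp (t * ω i + t ^ 2 * ω i ^ 2 / (1 - 2 * t * W)) := by
    refine inv_sqrt_le_exp (by linarith) ?_
    refine (neg_log_one_sub_le (by positivity) (by linarith)).trans ?_
    have h3 : (2 * (t * ω i)) ^ 2 / (2 * (1 - 2 * (t * ω i))) ≤
        (2 * (t * ω i)) ^ 2 / (2 * (1 - 2 * t * W)) := by
      refine div_le_div_of_nonneg_left (sq_nonneg _) (by linarith) (by linarith)
    have h4 : (2 * (t * ω i)) ^ 2 / (2 * (1 - 2 * t * W)) =
        2 * (t ^ 2 * ω i ^ 2 / (1 - 2 * t * W)) := by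
      have : 1 - 2 * t * W ≠ 0 := by linarith
      field_simp
    linarith
  calc _ ≤ Real.exp (-(t * ω i)) * Real.exp (t * ω i + t ^ 2 * ω i ^ 2 / (1 - 2 * t * W)) := by
        gcongr
    _ = _ := by rw [← Real.exp_add]; congr 1; ring

/-- Lower tail of a noncentral weighted chi-square sum with small weights. -/
lemma measure_weighted_sum_le_le (f : I → ι) (hf : Function.Injective f) (J : Finset I)
    (ω μ : I → ℝ) {W t a s : ℝ} (hω : ∀ i, 0 ≤ ω i) (hW : ∀ i, ω i ≤ W) (hW0 : 0 ≤ W)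
    (hsq : ∑ i ∈ J, ω i ^ 2 = 1 / 2) (ha : a ≤ ∑ i ∈ J, ω i * μ i ^ 2) (hs : 0 ≤ s) :
    (Measure.infinitePi fun _ : ι => gaussianReal 0 1).real
      {ξ | ∑ i ∈ J, ω i * ((ξ (f i) + μ i) ^ 2 - 1) ≤ t} ≤
    Real.exp (s * t + s ^ 2 / 2 - s * a / (1 + 2 * s * W)) := by
  have hpos : ∀ i, 0 ≤ s * ω i := fun i => mul_nonneg hs (hω i)
  have hle : ∀ i, s * ω i ≤ s * W := fun i => mul_le_mul_of_nonneg_left (hW i) hs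
  obtain ⟨hint, hmgf⟩ := mgf_weighted_sum f hf J ω μ (-s) fun i _ => by linarith [hpos i]
  have h1 := measure_le_le_exp_mul_mgf (μ := Measure.infinitePi fun _ : ι => gaussianReal 0 1)
    (X := fun ξ : ι → ℝ => ∑ i ∈ J, ω i * ((ξ (f i) + μ i) ^ 2 - 1)) t (neg_nonpos.2 hs) hint
  refine h1.trans ?_
  rw [hmgf, neg_neg]
  have hD : 0 < 1 + 2 * s * W := by positivity
  calc _ ≤ Real.exp (s * t) *
        ∏ i ∈ J, Real.exp (s ^ 2 * ω i ^ 2 - s * (ω i * μ i ^ 2) / (1 + 2 * s * W)) := by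
        gcongr with i hi
        have hi0 := hpos i
        have hi1 := hle i
        have hD' : 0 < 1 - 2 * (-s * ω i) := by linarith
        have h2 : (√(1 - 2 * (-s * ω i)))⁻¹ ≤ Real.exp (-(s * ω i) + s ^ 2 * ω i ^ 2) := by
          refine inv_sqrt_le_exp hD' ?_
          have := sub_sq_half_le_log (x := 2 * (s * ω i)) (by positivity)
          rw [show 1 - 2 * (-s * ω i) = 1 + 2 * (s * ω i) by ring]
          linarith [show (2 * (s * ω i)) ^ 2 = 4 * (s ^ 2 * ω i ^ 2) by ring]
        have h3 : -s * ω i * μ i ^ 2 / (1 - 2 * (-s * ω i)) ≤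
            -(s * (ω i * μ i ^ 2) / (1 + 2 * s * W)) := by
          rw [show -s * ω i * μ i ^ 2 = -(s * (ω i * μ i ^ 2)) by ring, neg_div, neg_le_neg_iff]
          refine div_le_div_of_nonneg_left ?_ hD' (by linarith)
          have := hω i
          positivity
        calc _ ≤ Real.exp (-(-s * ω i)) * (Real.exp (-(s * ω i) + s ^ 2 * ω i ^ 2) *
              Real.exp (-(s * (ω i * μ i ^ 2) / (1 + 2 * s * W)))) := by gcongr
          _ = _ := by rw [← Real.exp_add, ← Real.exp_add]; congr 1; ring
    _ = Real.exp (s * t + s ^ 2 / 2 - s * (∑ i ∈ J, ω i * μ i ^ 2) / (1 + 2 * s * W)) := by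
        rw [← Real.exp_sum, ← Real.exp_add, Finset.sum_sub_distrib, ← Finset.sum_div,
          ← Finset.mul_sum, ← Finset.mul_sum, hsq]
        congr 1; ring
    _ ≤ _ := by gcongr

end Gaussian
-- The Hamming risk as a sum of error probabilities.
section Risk

variable {k d : ℕ} {σ ε ρ τ : ℝ}

instance (k d : ℕ) : IsProbabilityMeasure (noise k d) := by
  unfold noise; infer_instance

/-- Since the weights have finite support, the statistic is a finite sum for every noise
realization, and its measurability and convergence are no issue. -/
lemma stat_observe (hε : 0 < ε) (η : Comp k d → ℕ) (θ : (u : Comp k d) → Freq u.1 → ℝ)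
    (u : Comp k d) (m : ℕ)
    (hfin : (weight (coeff σ u.1) ε (rStarGrid σ ε ρ u m)).support.Finite)
    (ξ : ObsIndex k d → ℝ) :
    stat σ ε ρ (observe ε η θ ξ) u m = ∑ l ∈ hfin.toFinset,
      weight (coeff σ u.1) ε (rStarGrid σ ε ρ u m) l *
        ((ξ ⟨u, l⟩ + η u * θ u l / ε) ^ 2 - 1) := by
  rw [stat, tsum_eq_sum (s := hfin.toFinset)]
  · refine Finset.sum_congr rfl fun l _ => ?_
    simp only [observe]
    congr 3
    field_simp
    ring
  · intro l hl
    have : weight (coeff σ u.1) ε (rStarGrid σ ε ρ u m) l = 0 := by simpa using hl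
    rw [this, zero_mul]

lemma selector_eq_zero {X : ObsIndex k d → ℝ} {u : Comp k d}
    (h : ∀ m ∈ Finset.Icc 1 (gridSize ρ), stat σ ε ρ X u m ≤ threshold ρ τ k d) :
    selector σ ε ρ τ X u = 0 := by
  rw [selector, ← Nat.bot_eq_zero, Finset.sup_eq_bot_iff]
  intro m hm
  simp [not_lt.2 (h m hm)]

lemma selector_le_one (X : ObsIndex k d → ℝ) (u : Comp k d) : selector σ ε ρ τ X u ≤ 1 :=
  Finset.sup_le fun m _ => by split_ifs <;> simp

lemma selector_eq_one {X : ObsIndex k d → ℝ} {u : Comp k d} {m : ℕ}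
    (hm : m ∈ Finset.Icc 1 (gridSize ρ)) (h : threshold ρ τ k d < stat σ ε ρ X u m) :
    selector σ ε ρ τ X u = 1 := by
  refine le_antisymm (selector_le_one X u) ?_
  have := Finset.le_sup (f := fun m =>
    open Classical in if threshold ρ τ k d < stat σ ε ρ X u m then 1 else 0) hm
  simp only [if_pos h] at this
  exact this

open Classical in
/-- The event, on which the selector errs at `u`, is contained in this one. -/
def errorEvent (σ ε ρ τ : ℝ) (η : Comp k d → ℕ) (θ : (u : Comp k d) → Freq u.1 → ℝ) (m₀ : ℕ)
    (u : Comp k d) : Set (ObsIndex k d → ℝ) :=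
  if η u = 0 then
    ⋃ m ∈ Finset.Icc 1 (gridSize ρ),
      {ξ | threshold ρ τ k d < stat σ ε ρ (observe ε η θ ξ) u m}
  else {ξ | stat σ ε ρ (observe ε η θ ξ) u m₀ ≤ threshold ρ τ k d}

/-- A false positive needs some grid statistic above the threshold, hence the union over `m`. A
false negative keeps all of them at or below it, so any one fixed `m₀` bounds it. -/
lemma hammingRisk_le_sum {η : Comp k d → ℕ} (hη : ∀ u, η u = 0 ∨ η u = 1)
    (θ : (u : Comp k d) → Freq u.1 → ℝ) {m₀ : ℕ} (hm₀ : m₀ ∈ Finset.Icc 1 (gridSize ρ))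
    (hmeas : ∀ u, ∀ m ∈ Finset.Icc 1 (gridSize ρ),
      Measurable fun ξ => stat σ ε ρ (observe ε η θ ξ) u m) :
    hammingRisk ε (selector σ ε ρ τ) η θ ≤
      ∑ u, noise k d (errorEvent σ ε ρ τ η θ m₀ u) := by
  have hms : ∀ u, MeasurableSet (errorEvent σ ε ρ τ η θ m₀ u) := by
    intro u
    rw [errorEvent]
    split_ifs
    · exact Finset.measurableSet_biUnion _ fun m hm => measurableSet_lt measurable_const (hmeas u m hm)
    · exact measurableSet_le (hmeas u m₀ hm₀) measurable_const
  rw [hammingRisk]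
  calc _ ≤ ∫⁻ ξ, ∑ u, (errorEvent σ ε ρ τ η θ m₀ u).indicator 1 ξ ∂(noise k d) := by
        refine lintegral_mono fun ξ => ?_
        rw [ENNReal.ofReal_sum_of_nonneg fun u _ => abs_nonneg _]
        refine Finset.sum_le_sum fun u _ => ?_
        by_cases hmem : ξ ∈ errorEvent σ ε ρ τ η θ m₀ u
        · rw [Set.indicator_of_mem hmem, Pi.one_apply, ENNReal.ofReal_le_one]
          have h1 : (selector σ ε ρ τ (observe ε η θ ξ) u : ℝ) ≤ 1 := by
            exact_mod_cast selector_le_one _ u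
          have h2 : (0 : ℝ) ≤ selector σ ε ρ τ (observe ε η θ ξ) u := Nat.cast_nonneg _
          rw [abs_le]
          rcases hη u with h | h <;> rw [h] <;> push_cast <;> constructor <;> linarith
        · rw [Set.indicator_of_notMem hmem]
          rw [errorEvent] at hmem
          rcases hη u with h | h
          · rw [if_pos h] at hmem
            simp only [Set.mem_iUnion, Set.mem_ofPred_eq, not_exists, not_lt] at hmem
            rw [selector_eq_zero hmem, h]
            simp
          · rw [if_neg (by omega)] at hmem
            simp only [Set.mem_ofPred_eq, not_le] at hmem
            rw [selector_eq_one hm₀ hmem, h]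
            simp
    _ = _ := by
        rw [lintegral_finsetSum _ fun u _ => measurable_one.indicator (hms u)]
        exact Finset.sum_congr rfl fun u _ => lintegral_indicator_one (hms u)

/-- Nonasymptotic bound for the risk of the selector. -/
lemma hammingRisk_le (hε : 0 < ε) {η : Comp k d → ℕ} (hη : ∀ u, η u = 0 ∨ η u = 1)
    {θ : (u : Comp k d) → Freq u.1 → ℝ} {m₀ : ℕ} (hm₀ : m₀ ∈ Finset.Icc 1 (gridSize ρ))
    {a : ℕ → ℝ} {W s : ℝ}
    (hG : ∀ u : Comp k d, ∀ m ∈ Finset.Icc 1 (gridSize ρ), GoodWeight (coeff σ u.1) ε (a m) W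
      (rStarGrid σ ε ρ u m) (weight (coeff σ u.1) ε (rStarGrid σ ε ρ u m)))
    (hθ : ∀ u, θ u ∈ PuncturedEllipsoid (coeff σ u.1) (rStarGrid σ ε ρ u m₀))
    (hW0 : 0 ≤ W) (hW : 2 * threshold ρ τ k d * W < 1) (hs : 0 ≤ s) :
    hammingRisk ε (selector σ ε ρ τ) η θ ≤ ENNReal.ofReal
      (d.choose k * (gridSize ρ * Real.exp (-threshold ρ τ k d ^ 2 +
          threshold ρ τ k d ^ 2 / (2 * (1 - 2 * threshold ρ τ k d * W)))) +
        (∑ u, (η u : ℝ)) * Real.exp (s * threshold ρ τ k d + s ^ 2 / 2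
          - s * a m₀ / (1 + 2 * s * W))) := by
  set t := threshold ρ τ k d with ht
  have ht0 : 0 ≤ t := Real.sqrt_nonneg _
  have hsq : ∀ u : Comp k d, ∀ m (hm : m ∈ Finset.Icc 1 (gridSize ρ)),
      ∑ l ∈ (hG u m hm).finite.toFinset,
        weight (coeff σ u.1) ε (rStarGrid σ ε ρ u m) l ^ 2 = 1 / 2 := by
    intro u m hm
    rw [← (hG u m hm).tsum_sq, tsum_eq_sum]
    intro l hl
    have : weight (coeff σ u.1) ε (rStarGrid σ ε ρ u m) l = 0 := by simpa using hl
    rw [this]; simp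
  have hinj : ∀ u : Comp k d, Function.Injective fun l : Freq u.1 => (⟨u, l⟩ : ObsIndex k d) :=
    fun u => @sigma_mk_injective (Comp k d) (fun u => Freq u.1) u
  refine (hammingRisk_le_sum hη θ hm₀ fun u m hm => ?_).trans ?_
  · simp only [stat_observe hε η θ u m (hG u m hm).finite]
    fun_prop
  set e₁ := Real.exp (-t ^ 2 + t ^ 2 / (2 * (1 - 2 * t * W)))
  set e₂ := Real.exp (s * t + s ^ 2 / 2 - s * a m₀ / (1 + 2 * s * W))
  have hbound : ∀ u, noise k d (errorEvent σ ε ρ τ η θ m₀ u) ≤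
      ENNReal.ofReal (gridSize ρ * e₁ + η u * e₂) := by
    intro u
    rw [← ofReal_measureReal]
    refine ENNReal.ofReal_le_ofReal ?_
    rw [errorEvent]
    rcases hη u with h | h
    · rw [if_pos h, h, Nat.cast_zero, zero_mul, add_zero]
      refine (measureReal_biUnion_finset_le _ _).trans ?_
      have : (gridSize ρ : ℝ) * e₁ = ∑ m ∈ Finset.Icc 1 (gridSize ρ), e₁ := by simp
      rw [this]
      refine Finset.sum_le_sum fun m hm => ?_
      have hg := hG u m hm
      simp only [stat_observe hε η θ u m hg.finite, h, Nat.cast_zero, zero_mul, zero_div,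
        add_zero]
      exact measure_lt_weighted_sum_le _ (hinj u) _ _ hg.nonneg hg.le (hsq u m hm) ht0 hW
    · rw [if_neg (by omega)]
      have hg := hG u m₀ hm₀
      simp only [stat_observe hε η θ u m₀ hg.finite, h, Nat.cast_one, one_mul]
      refine le_trans (measure_weighted_sum_le_le _ (hinj u) _ _ _ hg.nonneg hg.le hW0
        (hsq u m₀ hm₀) (a := a m₀) ?_ hs) (le_add_of_nonneg_left (by positivity))
      refine (hg.le_mean _ (hθ u)).trans (le_of_eq (tsum_eq_sum fun l hl => ?_))
      have : weight (coeff σ u.1) ε (rStarGrid σ ε ρ u m₀) l = 0 := by simpa using hl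
      rw [this, zero_mul]
  refine (Finset.sum_le_sum fun u _ => hbound u).trans (le_of_eq ?_)
  rw [← ENNReal.ofReal_sum_of_nonneg fun u _ => by positivity]
  congr 1
  rw [Finset.sum_add_distrib, ← Finset.sum_mul _ _ e₂, Finset.sum_const, Finset.card_univ,
    Fintype.card_finset_len, Fintype.card_fin, nsmul_eq_mul]

end Risk
-- The two exponents, and elementary asymptotics.
section Numeric

/-- Here `m` is `log M`. The main term `-t ^ 2 / 2 = -(1 + τ / 2) * (L + m)` absorbs the union over
components and grid and leaves `-τ * L / 2`. The rest comes from `1 / (2 * (1 - x)) ≤ 1 / 2 + x` for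
`0 ≤ x ≤ 1 / 2`, with `x = 2 * t * W`. -/
lemma exponent_false_positive_le {L m τ t W : ℝ} (hL : 1 ≤ L) (hm0 : 0 ≤ m) (hmL : m ≤ L)
    (hτ0 : 0 ≤ τ) (hτ1 : τ ≤ 1) (ht0 : 0 ≤ t) (ht : t ^ 2 = (2 + τ) * (L + m)) (hW0 : 0 ≤ W)
    (hW : L ^ 2 * W ≤ 1 / 24) :
    2 * t * W ≤ 1 / 2 ∧
      L + m + (-t ^ 2 + t ^ 2 / (2 * (1 - 2 * t * W))) ≤ -(τ * L) / 2 + 72 * (L ^ 2 * W) := by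
  have ht2 : t ^ 2 ≤ 6 * L := by rw [ht]; nlinarith
  have htL : t ≤ 6 * L := by nlinarith
  have h1 : t * W ≤ 6 * (L ^ 2 * W) := by
    calc t * W ≤ 6 * L * W := by gcongr
      _ ≤ 6 * L ^ 2 * W := by gcongr; nlinarith
      _ = _ := by ring
  have h2 : 2 * t * W ≤ 1 / 2 := by linarith
  refine ⟨h2, ?_⟩
  have h3 : t ^ 2 / (2 * (1 - 2 * t * W)) ≤ t ^ 2 / 2 + t ^ 2 * (2 * t * W) := by
    have h4 : 0 ≤ 2 * t * W := by positivity
    rw [div_le_iff₀ (by linarith)]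
    have h5 : 0 ≤ t ^ 2 * ((2 * t * W) * (1 - 2 * (2 * t * W))) :=
      mul_nonneg (sq_nonneg _) (mul_nonneg h4 (by linarith))
    nlinarith
  have h6 : t ^ 2 * (2 * t * W) ≤ 72 * (L ^ 2 * W) := by
    calc t ^ 2 * (2 * t * W) ≤ 6 * L * (2 * (6 * L) * W) := by gcongr
      _ = _ := by ring
  have h7 : 0 ≤ τ * m := mul_nonneg hτ0 hm0
  nlinarith

/-- For `t = g`, `a = (1 + q) * g` and `W = 0` the Chernoff exponent at parameter `q * g` is `-(q *
g) ^ 2 / 2 = -q ^ 2 * L`, leaving `-(q ^ 2 - p ^ 2) * L`. The excess of `t` over `g` and the weights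
each use up at most a quarter of this margin. -/
lemma exponent_false_negative_le {L t W a q p g : ℝ} (hL : 0 ≤ L) (hq0 : 0 ≤ q) (hq1 : q ≤ 1)
    (hg0 : 0 ≤ g) (hg : g ^ 2 = 2 * L) (hpq : p ^ 2 ≤ q ^ 2)
    (ht : t ≤ (1 + (q ^ 2 - p ^ 2) / 8) * g) (ha : (1 + q) * g ≤ a) (hW0 : 0 ≤ W)
    (hW : 32 * (g * W) ≤ q ^ 2 - p ^ 2) :
    p ^ 2 * L + (q * g * t + (q * g) ^ 2 / 2 - q * g * a / (1 + 2 * (q * g) * W)) ≤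
      -((q ^ 2 - p ^ 2) / 2 * L) := by
  have hs0 : 0 ≤ q * g := by positivity
  have hx0 : 0 ≤ 2 * (q * g) * W := by positivity
  have h1 : q * g * ((1 + q) * g) * (1 - 2 * (q * g) * W) ≤
      q * g * a / (1 + 2 * (q * g) * W) := by
    rw [le_div_iff₀ (by positivity)]
    have h2 : q * g * ((1 + q) * g) ≤ q * g * a := by gcongr
    have h3 : 0 ≤ q * g * ((1 + q) * g) := by positivity
    nlinarith [mul_nonneg h3 (sq_nonneg (2 * (q * g) * W))]
  have h2 : q * g * t ≤ q * g * ((1 + (q ^ 2 - p ^ 2) / 8) * g) := by gcongr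
  have h3 : 2 * (q * g) * W ≤ (q ^ 2 - p ^ 2) / 16 := by
    have : q * (g * W) ≤ 1 * (g * W) := by gcongr
    nlinarith
  have h4 : q * g * ((1 + q) * g) * (2 * (q * g) * W) ≤ 4 * L * ((q ^ 2 - p ^ 2) / 16) := by
    have h5 : q * g * ((1 + q) * g) = q * (1 + q) * (2 * L) := by rw [← hg]; ring
    rw [h5]
    have h6 : q * (1 + q) ≤ 2 := by nlinarith
    have h7 : q * (1 + q) * (2 * L) ≤ 4 * L := by nlinarith
    gcongr
  have h5 : q * g * ((1 + (q ^ 2 - p ^ 2) / 8) * g) =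
      2 * L * q + 2 * L * (q * ((q ^ 2 - p ^ 2) / 8)) := by rw [← hg]; ring
  have h6 : L * (q * ((q ^ 2 - p ^ 2) / 8)) ≤ L * (1 * ((q ^ 2 - p ^ 2) / 8)) := by
    gcongr
  have h7 : q * g * ((1 + q) * g) * (1 - 2 * (q * g) * W) =
      2 * L * q + 2 * L * q ^ 2 - q * g * ((1 + q) * g) * (2 * (q * g) * W) := by
    rw [← hg]; ring
  have h8 : (q * g) ^ 2 / 2 = L * q ^ 2 := by rw [mul_pow, hg]; ring
  nlinarith

lemma tendsto_logBinom {k : ℕ} (hk : 1 ≤ k) : Tendsto (logBinom k) atTop atTop := by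
  refine Real.tendsto_log_atTop.comp ?_
  refine tendsto_natCast_atTop_atTop.comp ?_
  have h1 : ∀ n, n - k ≤ k.factorial * n.choose k := by
    intro n
    have h2 : (n + 1 - k) ^ k ≤ k.factorial * n.choose k := by
      have := Nat.pow_le_choose (α := ℚ) k n
      rw [div_le_iff₀ (by positivity)] at this
      rw [mul_comm]
      exact_mod_cast this
    rcases Nat.lt_or_ge n k with h | h
    · simp [Nat.sub_eq_zero_of_le h.le]
    · calc n - k ≤ n + 1 - k := by omega
        _ ≤ (n + 1 - k) ^ k := Nat.le_self_pow (by omega) _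
        _ ≤ _ := h2
  refine tendsto_atTop.2 fun b => ?_
  filter_upwards [eventually_ge_atTop (k.factorial * b + k)] with n hn
  have h3 := h1 n
  exact Nat.le_of_mul_le_mul_left (by omega : k.factorial * b ≤ k.factorial * n.choose k)
    k.factorial_pos

/-- The bound on the weights vanishes faster than any power of `log ε⁻¹`. -/
lemma tendsto_log_pow_mul_rpow (κ : ℝ) (hκ : 0 < κ) (n : ℕ) :
    Tendsto (fun ε : ℝ => Real.log ε⁻¹ ^ n * (16 * ε ^ 4 * Real.log ε⁻¹) ^ κ) (𝓝[>] 0) (𝓝 0) := by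
  have h1 : Tendsto (fun y : ℝ => 16 ^ κ * (y ^ (n + κ) * Real.exp (-(4 * κ) * y))) atTop
      (𝓝 (16 ^ κ * 0)) :=
    (tendsto_rpow_mul_exp_neg_mul_atTop_nhds_zero (n + κ) (4 * κ) (by positivity)).const_mul _
  rw [mul_zero] at h1
  have h2 : Tendsto (fun ε : ℝ => Real.log ε⁻¹) (𝓝[>] 0) atTop :=
    Real.tendsto_log_atTop.comp tendsto_inv_nhdsGT_zero
  refine (h1.comp h2).congr' ?_
  filter_upwards [self_mem_nhdsWithin, h2.eventually_gt_atTop 0] with ε hε hy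
  have hε : 0 < ε := hε
  have h3 : ε ^ 4 = Real.exp (-4 * Real.log ε⁻¹) := by
    rw [Real.log_inv, show -4 * -Real.log ε = (4 : ℕ) * Real.log ε by push_cast; ring,
      Real.exp_nat_mul, Real.exp_log hε]
  simp only [Function.comp]
  rw [Real.mul_rpow (by positivity) hy.le, Real.mul_rpow (by positivity) (by positivity), h3,
    ← Real.exp_mul, Real.rpow_add hy, Real.rpow_natCast]
  rw [show -4 * Real.log ε⁻¹ * κ = -(4 * κ) * Real.log ε⁻¹ by ring]
  ring

/-- The grid point just above `1 - q ^ 2`. -/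
lemma exists_grid_point {ρ p q : ℝ} (hρ : 0 < ρ) (hp0 : 0 ≤ p) (hq1 : q < 1) (hpq : p < q)
    (hρq : ρ ≤ q ^ 2 - p ^ 2) :
    ∃ m ∈ Finset.Icc 1 (gridSize ρ), p ≤ √(1 - m * ρ) ∧ √(1 - m * ρ) ≤ q := by
  have hq0 : 0 ≤ q := hp0.trans hpq.le
  have hq2 : q ^ 2 < 1 := by nlinarith
  set m := ⌈(1 - q ^ 2) / ρ⌉₊ with hm
  have h1 : (1 - q ^ 2) / ρ ≤ m := Nat.le_ceil _
  have h2 : (m : ℝ) < (1 - q ^ 2) / ρ + 1 :=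
    Nat.ceil_lt_add_one (div_nonneg (by linarith) hρ.le)
  have h3 : 1 - q ^ 2 ≤ m * ρ := (div_le_iff₀ hρ).1 h1
  have h4 : m * ρ ≤ 1 - q ^ 2 + ρ := by
    calc m * ρ ≤ ((1 - q ^ 2) / ρ + 1) * ρ := by gcongr
      _ = _ := by field_simp
  refine ⟨m, Finset.mem_Icc.2 ⟨?_, ?_⟩, ?_, ?_⟩
  · exact Nat.ceil_pos.2 (div_pos (by linarith) hρ)
  · refine Nat.le_floor ?_
    rw [le_div_iff₀ hρ]
    nlinarith
  · exact Real.le_sqrt_of_sq_le (by linarith)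
  · exact Real.sqrt_le_iff.2 ⟨hq0, by linarith⟩

end Numeric

lemma GoodWeight.mono {I : Type} {c : I → ℝ} {ε a W W' r : ℝ} {ω : I → ℝ}
    (h : GoodWeight c ε a W r ω) (hW : W ≤ W') : GoodWeight c ε a W' r ω :=
  ⟨h.nonneg, fun i => (h.le i).trans hW, h.finite, h.tsum_sq, h.le_mean⟩

end ExactSelection

/-! ### Proof of the theorem. -/

open ExactSelection
set_option maxHeartbeats 1000000 in
theorem theorem1 (k : ℕ) (hk : 1 ≤ k) (β σ : ℝ) (hβ0 : 0 < β) (hβ1 : β < 1) (hσ : 0 < σ)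
    (d : ℝ → ℕ) (r ρ τ δ : ℝ → ℝ)
    -- the dimension grows, and not too fast compared with the noise level
    (hd : Tendsto d (𝓝[>] 0) atTop)
    (hlog : (fun ε => logBinom k (d ε)) =o[𝓝[>] 0] (fun ε => Real.log ε⁻¹))
    -- the grid step of the selector
    (hρ_pos : ∀ᶠ ε in 𝓝[>] 0, 0 < ρ ε)
    (hρ : Tendsto ρ (𝓝[>] 0) (𝓝 0))
    (hM : (fun ε => Real.log (gridSize (ρ ε))) =o[𝓝[>] 0] (fun ε => logBinom k (d ε)))
    -- the slack in the threshold of the selector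
    (hτ_pos : ∀ᶠ ε in 𝓝[>] 0, 0 < τ ε)
    (hτ : Tendsto τ (𝓝[>] 0) (𝓝 0))
    (hτ_log : Tendsto (fun ε => τ ε * logBinom k (d ε)) (𝓝[>] 0) atTop)
    -- the relative error in the sparsity condition
    (hδ : Tendsto δ (𝓝[>] 0) (𝓝 0))
    -- the identifiability condition
    (hr_pos : ∀ᶠ ε in 𝓝[>] 0, 0 < r ε)
    (hr : ENNReal.ofReal (√2 * (1 + √(1 - β))) <
      liminf (fun ε => aK σ ε k (r ε) / ENNReal.ofReal √(logBinom k (d ε))) (𝓝[>] 0)) :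
    limsup (fun ε => ⨆ η ∈ Sparse k (d ε) β (δ ε), ⨆ θ ∈ Signals k (d ε) σ (r ε),
      hammingRisk ε (selector σ ε (ρ ε) (τ ε)) η θ) (𝓝[>] 0) = 0 := by
  obtain ⟨C, κ, v₀, hC, hκ, hv₀, hgood⟩ := exists_goodWeight hk hσ
  set p : ℝ := √(1 - β) with hp
  have hp0 : 0 ≤ p := Real.sqrt_nonneg _
  have hp2 : p ^ 2 = 1 - β := Real.sq_sqrt (by linarith)
  have hp1 : p < 1 := by nlinarith
  -- a gain in the identifiability condition
  obtain ⟨q₁, hq₁r, hpq₁, hq₁1⟩ : ∃ q₁ : ℝ, ENNReal.ofReal (√2 * (1 + q₁)) <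
      liminf (fun ε => aK σ ε k (r ε) / ENNReal.ofReal √(logBinom k (d ε))) (𝓝[>] 0) ∧
      p < q₁ ∧ q₁ < 1 := by
    have hcont : Continuous fun q : ℝ => ENNReal.ofReal (√2 * (1 + q)) :=
      ENNReal.continuous_ofReal.comp (by fun_prop)
    have h1 : ∀ᶠ q in 𝓝[>] p, ENNReal.ofReal (√2 * (1 + q)) <
        liminf (fun ε => aK σ ε k (r ε) / ENNReal.ofReal √(logBinom k (d ε))) (𝓝[>] 0) :=
      nhdsWithin_le_nhds ((hcont.tendsto p).eventually (gt_mem_nhds hr))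
    obtain ⟨q, hq, hq'⟩ := (h1.and (Ioo_mem_nhdsGT hp1)).exists
    exact ⟨q, hq, hq'.1, hq'.2⟩
  -- The slack is split: the gap from `q` to `q₁` leaves room for a grid point, the gap from `p` to
  -- `q` gives the exponential decay of the false negatives.
  obtain ⟨q, hpq, hqq₁⟩ := exists_between hpq₁
  have hq0 : 0 < q := hp0.trans_lt hpq
  have hγ : 0 < q ^ 2 - p ^ 2 := by nlinarith
  have hγ₁ : 0 < q₁ ^ 2 - q ^ 2 := by nlinarith
  set γ : ℝ := (q ^ 2 - p ^ 2) / 8 with hγdef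
  have hγ0 : 0 < γ := by positivity
  set L : ℝ → ℝ := fun ε => logBinom k (d ε) with hLdef
  -- One bound for all weights on the grid: every level is at most `2 * √(2 * L)`, so `2 * ε ^ 4 * a
  -- ^ 2 ≤ 16 * ε ^ 4 * L`.
  set W : ℝ → ℝ := fun ε => C * (16 * ε ^ 4 * L ε) ^ κ with hWdef
  have hL : Tendsto L (𝓝[>] 0) atTop := (tendsto_logBinom hk).comp hd
  have hy : Tendsto (fun ε : ℝ => Real.log ε⁻¹) (𝓝[>] 0) atTop :=
    Real.tendsto_log_atTop.comp tendsto_inv_nhdsGT_zero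
  have hLy : ∀ᶠ ε in 𝓝[>] 0, L ε ≤ Real.log ε⁻¹ := by
    filter_upwards [hlog.bound one_pos, hy.eventually_ge_atTop 0] with ε h1 h2
    rw [one_mul, Real.norm_of_nonneg h2] at h1
    exact (le_abs_self _).trans h1
  have hLW : Tendsto (fun ε => L ε ^ 2 * W ε) (𝓝[>] 0) (𝓝 0) := by
    have h1 := (tendsto_log_pow_mul_rpow κ hκ 2).const_mul C
    rw [mul_zero] at h1
    refine tendsto_of_tendsto_of_tendsto_of_le_of_le' tendsto_const_nhds h1 ?_ ?_
    · filter_upwards [hL.eventually_ge_atTop 0] with ε h2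
      positivity
    · filter_upwards [hL.eventually_ge_atTop 0, hLy] with ε h2 h3
      calc L ε ^ 2 * W ε = C * (L ε ^ 2 * (16 * ε ^ 4 * L ε) ^ κ) := by simp only [hWdef]; ring
        _ ≤ C * (Real.log ε⁻¹ ^ 2 * (16 * ε ^ 4 * Real.log ε⁻¹) ^ κ) := by gcongr
  have hv : ∀ᶠ ε in 𝓝[>] 0, 16 * ε ^ 4 * L ε < v₀ := by
    have h1 := tendsto_log_pow_mul_rpow 1 one_pos 0
    filter_upwards [h1.eventually (gt_mem_nhds hv₀), hLy] with ε h2 h3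
    rw [pow_zero, one_mul, Real.rpow_one] at h2
    refine lt_of_le_of_lt ?_ h2
    gcongr
  -- the vanishing bound
  set G : ℝ → ℝ := fun ε => Real.exp (-(τ ε * L ε) / 2 + 72 * (L ε ^ 2 * W ε)) +
    2 * Real.exp (-((q ^ 2 - p ^ 2) / 2 * L ε)) with hG
  have hGlim : Tendsto (fun ε => ENNReal.ofReal (G ε)) (𝓝[>] 0) (𝓝 0) := by
    have h1 : Tendsto (fun ε => -(τ ε * L ε) / 2 + 72 * (L ε ^ 2 * W ε)) (𝓝[>] 0) atBot := by
      have h2 : Tendsto (fun ε => -(τ ε * L ε) / 2) (𝓝[>] 0) atBot :=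
        (tendsto_neg_atTop_atBot.comp hτ_log).atBot_div_const two_pos
      exact h2.atBot_add (hLW.const_mul 72)
    have h2 : Tendsto (fun ε => -((q ^ 2 - p ^ 2) / 2 * L ε)) (𝓝[>] 0) atBot :=
      tendsto_neg_atTop_atBot.comp (hL.const_mul_atTop (by positivity))
    have h3 := (Real.tendsto_exp_atBot.comp h1).add
      ((Real.tendsto_exp_atBot.comp h2).const_mul 2)
    rw [mul_zero, add_zero] at h3
    have h4 := ENNReal.tendsto_ofReal h3
    rwa [ENNReal.ofReal_zero] at h4
  refine (tendsto_of_tendsto_of_tendsto_of_le_of_le' tendsto_const_nhds hGlim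
    (Eventually.of_forall fun _ => zero_le) ?_).limsup_eq
  have hτ1 : ∀ᶠ ε in 𝓝[>] 0, τ ε ≤ min 1 γ := hτ.eventually (ge_mem_nhds (by positivity))
  have hδ1 : ∀ᶠ ε in 𝓝[>] 0, δ ε ≤ 1 := hδ.eventually (ge_mem_nhds one_pos)
  have hρ1 : ∀ᶠ ε in 𝓝[>] 0, ρ ε ≤ min 1 (q₁ ^ 2 - q ^ 2) :=
    hρ.eventually (ge_mem_nhds (by positivity))
  have hM1 : ∀ᶠ ε in 𝓝[>] 0, Real.log (gridSize (ρ ε)) ≤ min 1 (γ / 2) * L ε := by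
    filter_upwards [hM.bound (by positivity : 0 < min 1 (γ / 2)), hL.eventually_ge_atTop 0]
      with ε h1 h2
    rw [Real.norm_of_nonneg h2] at h1
    exact (le_abs_self _).trans h1
  have hLW1 : ∀ᶠ ε in 𝓝[>] 0, L ε ^ 2 * W ε ≤ min (1 / 24) ((q ^ 2 - p ^ 2) / 64) :=
    hLW.eventually (ge_mem_nhds (by positivity))
  filter_upwards [self_mem_nhdsWithin, hL.eventually_ge_atTop 1, hv, hτ_pos, hτ1, hδ1, hρ_pos,
    hρ1, hM1, hLW1, hr_pos, eventually_lt_of_lt_liminf hq₁r, hd.eventually_ge_atTop k]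
    with ε hε hL1 hv hτ0 hτ1 hδ1 hρ0 hρ1 hM1 hLW1 hr0 hra hdk
  have hε : 0 < ε := hε
  have hL0 : 0 < L ε := by linarith
  have hW0 : 0 ≤ W ε := by positivity
  set g : ℝ := √(2 * L ε) with hg
  have hg0 : 0 < g := by positivity
  have hg2 : g ^ 2 = 2 * L ε := Real.sq_sqrt (by positivity)
  have hgrid : 1 ≤ gridSize (ρ ε) := by
    refine Nat.le_floor ?_
    rw [Nat.cast_one, le_div_iff₀ hρ0, one_mul]
    exact hρ1.trans (min_le_left _ _)
  have hgrid' : (1 : ℝ) ≤ gridSize (ρ ε) := by exact_mod_cast hgrid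
  have hm0 : 0 ≤ Real.log (gridSize (ρ ε)) := Real.log_nonneg hgrid'
  have hmL : Real.log (gridSize (ρ ε)) ≤ L ε := hM1.trans (by
    calc min 1 (γ / 2) * L ε ≤ 1 * L ε := by gcongr; exact min_le_left _ _
      _ = L ε := one_mul _)
  set t := threshold (ρ ε) (τ ε) k (d ε) with ht
  have ht0 : 0 ≤ t := Real.sqrt_nonneg _
  have ht2 : t ^ 2 = (2 + τ ε) * (L ε + Real.log (gridSize (ρ ε))) :=
    Real.sq_sqrt (mul_nonneg (by linarith) (by linarith))
  -- the levels of the grid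
  set a : ℕ → ℝ := fun m => (1 + √(1 - m * ρ ε)) * g with ha
  have hweights : ∀ u : Comp k (d ε), ∀ m : ℕ, 0 < rStarGrid σ ε (ρ ε) u m ∧
      aVal (coeff σ u.1) ε (rStarGrid σ ε (ρ ε) u m) = ENNReal.ofReal (a m) ∧
      GoodWeight (coeff σ u.1) ε (a m) (W ε) (rStarGrid σ ε (ρ ε) u m)
        (weight (coeff σ u.1) ε (rStarGrid σ ε (ρ ε) u m)) := by
    intro u m
    have ha0 : 0 < a m := by positivity
    have ha2 : 2 * ε ^ 4 * a m ^ 2 ≤ 16 * ε ^ 4 * L ε := by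
      have h1 : √(1 - m * ρ ε) ≤ 1 := by
        rw [Real.sqrt_le_one]
        have : 0 ≤ m * ρ ε := by positivity
        linarith
      have h2 : a m ^ 2 ≤ (2 * g) ^ 2 := by
        simp only [ha]; gcongr; linarith
      calc 2 * ε ^ 4 * a m ^ 2 ≤ 2 * ε ^ 4 * (2 * g) ^ 2 := by gcongr
        _ = 16 * ε ^ 4 * L ε := by rw [mul_pow, hg2]; ring
    obtain ⟨h1, h2, h3⟩ := hgood (d ε) u.1 u.2 ε (a m) hε ha0 (ha2.trans_lt hv)
    refine ⟨h1, h2, GoodWeight.mono h3 ?_⟩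
    simp only [hWdef]
    gcongr
  obtain ⟨m₀, hm₀, hqm₀, hm₀q₁⟩ := exists_grid_point hρ0 hq0.le hq₁1 hqq₁
    (hρ1.trans (min_le_right _ _))
  have haK : ENNReal.ofReal (a m₀) < aK σ ε k (r ε) := by
    have hs : 0 < √(L ε) := by positivity
    rw [ENNReal.lt_div_iff_mul_lt (Or.inl (by simpa using hL0))
      (Or.inl ENNReal.ofReal_ne_top), ← ENNReal.ofReal_mul (mul_nonneg (Real.sqrt_nonneg 2) (by linarith))] at hra
    refine lt_of_le_of_lt (ENNReal.ofReal_le_ofReal ?_) hra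
    calc a m₀ ≤ (1 + q₁) * g := by simp only [ha]; gcongr
      _ = √2 * (1 + q₁) * √(L ε) := by rw [hg, Real.sqrt_mul two_pos.le]; ring
  have hexp := exponent_false_positive_le hL1 hm0 hmL hτ0.le (hτ1.trans (min_le_left _ _)) ht0 ht2
    hW0 (hLW1.trans (min_le_left _ _))
  have htg : t ≤ (1 + (q ^ 2 - p ^ 2) / 8) * g := by
    refine abs_le_of_sq_le_sq' ?_ (by positivity) |>.2
    have h1 : Real.log (gridSize (ρ ε)) ≤ γ / 2 * L ε := hM1.trans (by
      gcongr; exact min_le_right _ _)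
    have h2 : τ ε ≤ γ := hτ1.trans (min_le_right _ _)
    rw [ht2, mul_pow, hg2, ← hγdef]
    calc (2 + τ ε) * (L ε + Real.log (gridSize (ρ ε)))
        ≤ (2 + γ) * (L ε + γ / 2 * L ε) := by gcongr
      _ = (1 + γ / 2) ^ 2 * (2 * L ε) := by ring
      _ ≤ (1 + γ) ^ 2 * (2 * L ε) := by gcongr; linarith
  have hgW : 32 * (g * W ε) ≤ q ^ 2 - p ^ 2 := by
    have h0 : 1 ≤ g := by
      rw [hg, Real.one_le_sqrt]
      linarith
    have h1 : g ≤ 2 * L ε ^ 2 := by nlinarith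
    have h2 : g * W ε ≤ 2 * (L ε ^ 2 * W ε) := by
      calc g * W ε ≤ 2 * L ε ^ 2 * W ε := by gcongr
        _ = _ := by ring
    linarith [hLW1.trans (min_le_right _ _)]
  have hexp' := exponent_false_negative_le (a := a m₀) hL0.le hq0.le (hqq₁.trans hq₁1).le hg0.le hg2
    (by linarith) htg (by simp only [ha]; gcongr) hW0 hgW
  have hchoose : (0 : ℝ) < (d ε).choose k := by exact_mod_cast Nat.choose_pos hdk
  have hchooseL : ((d ε).choose k : ℝ) = Real.exp (L ε) := (Real.exp_log hchoose).symm
  refine iSup₂_le fun η hη => iSup₂_le fun θ hθ => ?_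
  have hθ' : ∀ u, θ u ∈ PuncturedEllipsoid (coeff σ u.1) (rStarGrid σ ε (ρ ε) u m₀) := by
    intro u
    obtain ⟨h1, h2, -⟩ := hweights u m₀
    -- The level at `m₀` is below `a(r)` and `a` is monotone, so `r*` is at most `r` and the signals
    -- lie outside the smaller ball as well.
    have hle : rStarGrid σ ε (ρ ε) u m₀ ≤ r ε := by
      by_contra! hlt
      have h3 := aVal_anti (c := coeff σ u.1) (ε := ε) hr0.le hlt.le
      rw [h2, ← aK_eq_aVal u.2] at h3
      exact absurd haK (not_lt.2 h3)
    have h3 := hθ u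
    exact ⟨h3.1, h3.2.1, h3.2.2.1, (pow_le_pow_left₀ h1.le hle 2).trans h3.2.2.2⟩
  refine (hammingRisk_le hε hη.1 hm₀ (fun u m _ => (hweights u m).2.2) hθ' hW0
    (by linarith [hexp.1]) (by positivity : 0 ≤ q * g)).trans (ENNReal.ofReal_le_ofReal ?_)
  refine add_le_add ?_ ?_
  · calc _ = Real.exp (L ε + Real.log (gridSize (ρ ε)) +
          (-t ^ 2 + t ^ 2 / (2 * (1 - 2 * t * W ε)))) := by
          rw [Real.exp_add (L ε + _), Real.exp_add (L ε), Real.exp_log (by linarith), hchooseL,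
            mul_assoc (Real.exp (L ε))]
      _ ≤ _ := Real.exp_le_exp.2 hexp.2
  · have h1 : ∑ u, (η u : ℝ) ≤ 2 * Real.exp (p ^ 2 * L ε) := by
      have h2 : ((d ε).choose k : ℝ) ^ (1 - β) = Real.exp (p ^ 2 * L ε) := by
        rw [hchooseL, ← Real.exp_mul, hp2, mul_comm]
      have h3 := (abs_le.1 hη.2).2
      rw [h2] at h3
      nlinarith [Real.exp_pos (p ^ 2 * L ε)]
    calc _ ≤ 2 * Real.exp (p ^ 2 * L ε) * Real.exp (q * g * t + (q * g) ^ 2 / 2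
          - q * g * a m₀ / (1 + 2 * (q * g) * W ε)) := by gcongr
      _ = 2 * Real.exp (p ^ 2 * L ε + (q * g * t + (q * g) ^ 2 / 2
          - q * g * a m₀ / (1 + 2 * (q * g) * W ε))) := by rw [Real.exp_add, mul_assoc]
      _ ≤ _ := by gcongr
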